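/- Let $X$ be a complex manifold of dimension $d$, let $D\subset X$ be a normal crossing divisor, let $W\subseteq X$ be open, and let $\omega$ be a smooth complex-valued differential form (of some degree $n$) on $W\setminus D$. A coordinate neighborhood $V$ with holomorphic coordinates $z_1,\dots,z_d$ is called adapted to $D$ if, after renumbering the coordinates, $D\cap V$ is given by $z_1\cdots z_k=0$ for some $0\le k\le d$, and $|z_i|\le 1/e^{e}$ on $V$ for all $i$. For multi-indices write $|\alpha|=\sum_i\alpha_i$. (a) Let $V$ be adapted to $D$ and let $V'\subseteq V$ be open. A smooth function $f$ on $V'\setminus D$ has logarithmic growth of infinite order if for every integer $K\ge 0$ there is an integer $N_K$ such that for all $\alpha,\beta\in\mathbb{Z}_{\ge0}^d$ with $|\alpha|+|\beta|\le K$ there is a constant $C>0$ with $$\left|\frac{\partial^{|\alpha|}}{\partial z^\alpha}\frac{\partial^{|\beta|}}{\partial\bar z^\beta}f\right|\le C\,\frac{\left|\prod_{i=1}^k\log(1/|z_i|)\right|^{N_K}}{\prod_{i=1}^k|z_i|^{\alpha_i+\beta_i}}\qquad\text{on } V'\setminus D.$$ The form $\omega$ is a log form on $W$ if, for every $V\subseteq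 W$ adapted to $D$, every point of $V$ has an open neighborhood $V'\subseteq V$ such that, on $V'\setminus D$, $\omega$ lies in the algebra of differential forms generated by the functions on $V'\setminus D$ with logarithmic growth of infinite order and the differentials $dz_i/z_i,\ d\bar z_i/\bar z_i$ ($i\le k$) and $dz_i,\ d\bar z_i$ ($i>k$). (b) For $M>1$ put $U_M=\{x\in\mathbb{C}\mid \operatorname{Im}x>M\}$. For $K'\subseteq\mathbb{C}^{d-k}$ open, a smooth function $g$ on $(U_M)^k\times K'$ has imaginary polynomial growth if there are integers $(N_m)_{m\ge0}$ such that for all $\alpha,\beta\in\mathbb{Z}_{\ge0}^d$ there is a constant $C>0$ with $$\left|\frac{\partial^{|\alpha|}}{\partial x^\alpha}\frac{\partial^{|\beta|}}{\partial\bar x^\beta}g\right|\le C\left|\prod_{i=1}^k\operatorname{Im}x_i\right|^{N_{|\alpha|+|\beta|}}\qquad\text{on } (U_M)^k\times K'.$$ A differential form on $(U_M)^k\times K'$ has imaginary polynomial growth if it lies in the algebra generated by these functions and the differentials $dx_i,\ d\bar x_i$, $1\le i\le d$. Let $\Delta_r=\{|z|<r\}$. The form $\omega$ has polynomial growth in the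 local universal cover on $W$ if, for every $V\subseteq W$ adapted to $D$ whose coordinates identify $V$ with a product $(\Delta_r)^k\times K$, where $r>0$ and $K\subseteq\mathbb{C}^{d-k}$ is open, and for every $M>\max(1,\log(1/r))$, the following holds for the map $$\pi:(U_M)^k\times K\to V\setminus D,\qquad \pi(x_1,\dots,x_d)=(e^{2\pi i x_1},\dots,e^{2\pi i x_k},x_{k+1},\dots,x_d):$$ every point of $K$ has an open neighborhood $K'\subseteq K$ such that $\pi^*\omega$ has imaginary polynomial growth on $(U_M)^k\times K'$. Theorem. The form $\omega$ has polynomial growth in the local universal cover on $W$ if and only if it is a log form on $W$. -/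

import Mathlib

open Set
open scoped Manifold ContDiff

noncomputable section

namespace LogForms

/-- The coordinate space `ℂ^d`, the model space of complex manifolds of dimension `d`. -/
abbrev Cd (d : ℕ) : Type := Fin d → ℂ

section Functions

variable {d : ℕ}

/-- The Wirtinger derivative `∂f/∂z_i = (1/2) (∂f/∂x_i - √-1 ∂f/∂y_i)`. -/
def partialZ (i : Fin d) (f : Cd d → ℂ) : Cd d → ℂ := fun z =>
  (1 / 2 : ℂ) * (fderiv ℝ f z (Pi.single i 1) - Complex.I * fderiv ℝ f z (Pi.single i Complex.I))

/-- The Wirtinger derivative `∂f/∂z̄_i = (1/2) (∂f/∂x_i + √-1 ∂f/∂y_i)`. -/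
def partialZbar (i : Fin d) (f : Cd d → ℂ) : Cd d → ℂ := fun z =>
  (1 / 2 : ℂ) * (fderiv ℝ f z (Pi.single i 1) + Complex.I * fderiv ℝ f z (Pi.single i Complex.I))

/-- `∂^{|α|}f/∂z^α = (∂/∂z_1)^{α_1} ⋯ (∂/∂z_d)^{α_d} f`. -/
def iterPartialZ (α : Fin d → ℕ) (f : Cd d → ℂ) : Cd d → ℂ :=
  (List.finRange d).foldr (fun i g => (partialZ i)^[α i] g) f

/-- `∂^{|β|}f/∂z̄^β = (∂/∂z̄_1)^{β_1} ⋯ (∂/∂z̄_d)^{β_d} f`. -/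
def iterPartialZbar (β : Fin d → ℕ) (f : Cd d → ℂ) : Cd d → ℂ :=
  (List.finRange d).foldr (fun i g => (partialZbar i)^[β i] g) f

/-- The order `|α|` of a multi-index. -/
def order (α : Fin d → ℕ) : ℕ := ∑ i, α i

/-- `f` is a smooth function on `Ω` with logarithmic growth of order `K` along the coordinate
hyperplanes `z_i = 0`, `i ∈ S`; the set `Ω` is meant to be an open subset of `ℂ^d` that does not
meet these hyperplanes. The exponent depends on `K` only, the constant also on `α` and `β`. -/
def HasLogGrowthOfOrder (S : Finset (Fin d)) (Ω : Set (Cd d)) (K : ℕ) (f : Cd d → ℂ) : Prop :=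
  ContDiffOn ℝ ∞ f Ω ∧
  ∃ N : ℤ, ∀ α β : Fin d → ℕ, order α + order β ≤ K →
    ∃ C : ℝ, 0 < C ∧ ∀ z ∈ Ω,
      ‖iterPartialZ α (iterPartialZbar β f) z‖ ≤
        C * (|∏ i ∈ S, Real.log (1 / ‖z i‖)| ^ N / ∏ i ∈ S, ‖z i‖ ^ (α i + β i))

/-- Logarithmic growth of infinite order. -/
def HasLogGrowth (S : Finset (Fin d)) (Ω : Set (Cd d)) (f : Cd d → ℂ) : Prop :=
  ∀ K : ℕ, HasLogGrowthOfOrder S Ω K f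

/-- `f` is a smooth function on `Ω` with imaginary polynomial growth with respect to the
coordinates `x_i`, `i ∈ S`. -/
def HasImPolyGrowth (S : Finset (Fin d)) (Ω : Set (Cd d)) (f : Cd d → ℂ) : Prop :=
  ContDiffOn ℝ ∞ f Ω ∧
  ∃ N : ℕ → ℤ, ∀ α β : Fin d → ℕ, ∃ C : ℝ, 0 < C ∧ ∀ x ∈ Ω,
    ‖iterPartialZ α (iterPartialZbar β f) x‖ ≤
      C * |∏ i ∈ S, (x i).im| ^ N (order α + order β)

end Functions

section FormsOnCd

variable {d n : ℕ}

/-- The covectors `dz_i` (index `inl i`) and `dz̄_i` (index `inr i`). -/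
def coordForm : Fin d ⊕ Fin d → (Cd d →L[ℝ] ℂ)
  | .inl i => ContinuousLinearMap.proj i
  | .inr i => (Complex.conjCLE : ℂ →L[ℝ] ℂ).comp (ContinuousLinearMap.proj i)

/-- The covectors at `z` of the forms `dz_i / z_i` and `dz̄_i / z̄_i` for `i ∈ S`, and
`dz_i` and `dz̄_i` for `i ∉ S`. -/
def logCoordForm (S : Finset (Fin d)) (z : Cd d) : Fin d ⊕ Fin d → (Cd d →L[ℝ] ℂ)
  | .inl i => if i ∈ S then (z i)⁻¹ • coordForm (.inl i) else coordForm (.inl i)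
  | .inr i => if i ∈ S then (starRingEnd ℂ (z i))⁻¹ • coordForm (.inr i) else coordForm (.inr i)

/-- `θ` agrees on `Ω` with a finite sum of terms `c · η_{a_1} ∧ ⋯ ∧ η_{a_n}`, where the coefficient
functions `c` satisfy `P`. When the functions with property `P` form an algebra, this is the
degree `n` part of the algebra of forms on `Ω` that they generate together with the one-forms `η_b`.
The exterior product is written out as
`(η_{a_1} ∧ ⋯ ∧ η_{a_n}) (v_1, …, v_n) = det (η_{a_j} (v_i))`. -/
def GeneratedOn (P : (Cd d → ℂ) → Prop) (η : Cd d → Fin d ⊕ Fin d → (Cd d →L[ℝ] ℂ))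
    (Ω : Set (Cd d)) (θ : Cd d → (Cd d [⋀^Fin n]→L[ℝ] ℂ)) : Prop :=
  ∃ c : (Fin n → Fin d ⊕ Fin d) → Cd d → ℂ, (∀ a, P (c a)) ∧
    ∀ z ∈ Ω, ∀ v : Fin n → Cd d,
      θ z v = ∑ a, c a z * (Matrix.of fun i j : Fin n => η z (a j) (v i)).det

/-- The `n`-forms on `Ω` generated by the functions on `Ω` with logarithmic growth of infinite order
and the differentials `dz_i / z_i`, `dz̄_i / z̄_i` (`i ∈ S`), `dz_i`, `dz̄_i` (`i ∉ S`). -/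
def IsLogFormInCoords (S : Finset (Fin d)) (Ω : Set (Cd d))
    (θ : Cd d → (Cd d [⋀^Fin n]→L[ℝ] ℂ)) : Prop :=
  GeneratedOn (HasLogGrowth S Ω) (logCoordForm S) Ω θ

/-- The `n`-forms on `Ω` with imaginary polynomial growth: those generated by the functions on `Ω`
with imaginary polynomial growth and the differentials `dx_i`, `dx̄_i`. -/
def FormHasImPolyGrowth (S : Finset (Fin d)) (Ω : Set (Cd d))
    (θ : Cd d → (Cd d [⋀^Fin n]→L[ℝ] ℂ)) : Prop :=
  GeneratedOn (HasImPolyGrowth S Ω) (fun _ => coordForm) Ω θ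

/-- The product `(Δ_r)^S × K` in `ℂ^d`, where `K ⊆ ℂ^{Sᶜ}`. -/
def discProd (S : Finset (Fin d)) (r : ℝ) (K : Set ({i : Fin d // i ∉ S} → ℂ)) : Set (Cd d) :=
  {z | (∀ i ∈ S, ‖z i‖ < r) ∧ (fun i : {i : Fin d // i ∉ S} => z i) ∈ K}

/-- The product `(U_M)^S × K` in `ℂ^d`, where `U_M = {x | Im x > M}` and `K ⊆ ℂ^{Sᶜ}`. -/
def halfPlaneProd (S : Finset (Fin d)) (M : ℝ) (K : Set ({i : Fin d // i ∉ S} → ℂ)) :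
    Set (Cd d) :=
  {x | (∀ i ∈ S, M < (x i).im) ∧ (fun i : {i : Fin d // i ∉ S} => x i) ∈ K}

/-- The map `x ↦ z` with `z_i = exp (2 π √-1 x_i)` for `i ∈ S` and `z_i = x_i` for `i ∉ S`. -/
def expMap (S : Finset (Fin d)) (x : Cd d) : Cd d := fun i =>
  if i ∈ S then Complex.exp (2 * Real.pi * Complex.I * x i) else x i

end FormsOnCd

section Manifold

variable {d : ℕ} {X : Type*} [TopologicalSpace X] [ChartedSpace (Cd d) X]

instance tangentModuleReal (x : X) : Module ℝ (TangentSpace 𝓘(ℂ, Cd d) x) :=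
  inferInstanceAs (Module ℝ (Cd d))

instance tangentScalarTower (x : X) : IsScalarTower ℝ ℂ (TangentSpace 𝓘(ℂ, Cd d) x) :=
  inferInstanceAs (IsScalarTower ℝ ℂ (Cd d))

variable (d X) in
/-- Complex valued differential forms of degree `n` on `X` (with no regularity assumption): an
`ℝ`-multilinear alternating form on each tangent space. -/
abbrev Form (n : ℕ) : Type _ := (p : X) → (TangentSpace 𝓘(ℂ, Cd d) p [⋀^Fin n]→L[ℝ] ℂ)

/-- The pull-back `g^* θ` of a form on `X` by a holomorphic map `g` from (an open subset of) `ℂ^d`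
to `X`. -/
def pullback {n : ℕ} (g : Cd d → X) (θ : Form d X n) (z : Cd d) : Cd d [⋀^Fin n]→L[ℝ] ℂ :=
  (θ (g z)).compContinuousLinearMap
    ((mfderiv 𝓘(ℂ, Cd d) 𝓘(ℂ, Cd d) g z).restrictScalars ℝ :
      TangentSpace 𝓘(ℂ, Cd d) z →L[ℝ] TangentSpace 𝓘(ℂ, Cd d) (g z))

/-- `θ` is a smooth form on the open set `U`: it is smooth in every holomorphic chart. -/
def IsSmoothFormOn {n : ℕ} (U : Set X) (θ : Form d X n) : Prop :=
  ∀ φ ∈ IsManifold.maximalAtlas 𝓘(ℂ, Cd d) ω X,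
    ContDiffOn ℝ ∞ (pullback φ.symm θ) (φ.target ∩ φ.symm ⁻¹' U)

/-- The holomorphic chart `φ = (z_1, …, z_d)` with domain `V` is such that `D ∩ V` is given by the
equation `∏_{i ∈ S} z_i = 0`. Numbering the coordinates so that `S = {1, …, k}` gives the
equation `z_1 ⋯ z_k = 0`. -/
def IsCoordinateEquation (D : Set X) (φ : OpenPartialHomeomorph X (Cd d)) (S : Finset (Fin d)) :
    Prop :=
  φ ∈ IsManifold.maximalAtlas 𝓘(ℂ, Cd d) ω X ∧ ∀ p ∈ φ.source, p ∈ D ↔ ∏ i ∈ S, φ p i = 0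

variable (d) in
/-- The subset `D` of `X` is (the support of) a normal crossing divisor. -/
def IsNormalCrossing (D : Set X) : Prop :=
  ∀ p : X, ∃ (φ : OpenPartialHomeomorph X (Cd d)) (S : Finset (Fin d)),
    p ∈ φ.source ∧ IsCoordinateEquation D φ S

/-- The chart `φ` is adapted to `D`: `D` is given by `∏_{i ∈ S} z_i = 0` in its domain, and all
coordinates satisfy `|z_i| ≤ 1 / e^e`. -/
def IsAdapted (D : Set X) (φ : OpenPartialHomeomorph X (Cd d)) (S : Finset (Fin d)) : Prop :=
  IsCoordinateEquation D φ S ∧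
    ∀ p ∈ φ.source, ∀ i, ‖φ p i‖ ≤ 1 / Real.exp (Real.exp 1)

/-- `θ` is a section over `W` of the sheaf of log forms along `D`: in each coordinate neighborhood
`V ⊆ W` adapted to `D`, with coordinates `φ`, it is locally generated by functions with logarithmic
growth of infinite order and by the differentials `dz_i / z_i`, `dz̄_i / z̄_i` (`i ∈ S`), `dz_i`,
`dz̄_i` (`i ∉ S`). Here `O` is (the image in `ℂ^d` of) a neighborhood of the given point of `V`, on
which the generation and the estimates take place. -/
def IsLogForm {n : ℕ} (D W : Set X) (θ : Form d X n) : Prop :=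
  ∀ (φ : OpenPartialHomeomorph X (Cd d)) (S : Finset (Fin d)), IsAdapted D φ S → φ.source ⊆ W →
    ∀ p ∈ φ.source, ∃ O : Set (Cd d), IsOpen O ∧ φ p ∈ O ∧ O ⊆ φ.target ∧
      IsLogFormInCoords S (O \ φ.symm ⁻¹' D) (pullback φ.symm θ)

/-- `θ` has polynomial growth in the local universal cover over `W`: for every coordinate
neighborhood `V ⊆ W` adapted to `D` whose coordinates `φ` identify `V` with `(Δ_r)^S × K` (hence
`V \ D` with `(Δ_r^*)^S × K`), and for every `M > log (1 / r)`, the pull-back of `θ` by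
`π : (U_M)^S × K → V \ D` has imaginary polynomial growth, locally over `K`. -/
def HasPolyGrowthInLocalUniversalCover {n : ℕ} (D W : Set X) (θ : Form d X n) : Prop :=
  ∀ (φ : OpenPartialHomeomorph X (Cd d)) (S : Finset (Fin d)) (r : ℝ)
    (K : Set ({i : Fin d // i ∉ S} → ℂ)),
    IsAdapted D φ S → φ.source ⊆ W → 0 < r → IsOpen K → φ.target = discProd S r K →
    ∀ M : ℝ, 1 < M → Real.log (1 / r) < M →
      ∀ y ∈ K, ∃ K' : Set ({i : Fin d // i ∉ S} → ℂ), IsOpen K' ∧ y ∈ K' ∧ K' ⊆ K ∧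
        FormHasImPolyGrowth S (halfPlaneProd S M K') (pullback (φ.symm ∘ expMap S) θ)

end Manifold

end LogForms

end

/-! For `i ∈ S` the substitution `z_i = exp (2πi x_i)` gives `∂/∂x_i = 2πi z_i ∂/∂z_i`, `dz_i/z_i =
2πi dx_i` and `log (1/|z_i|) = 2π Im x_i`. Up to nonzero constants it therefore exchanges
logarithmic derivatives, logarithmic differentials and the product of logarithms downstairs with
plain derivatives, plain differentials and the product of imaginary parts upstairs.

The analytic point is that bounding all `z^α z̄^β ∂^α ∂̄^β f` amounts to bounding all iterated
logarithmic derivatives of `f` (`growthClass_wd_iff_logWd`): commuting a coordinate past a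
derivative produces only lower order terms. This yields the comparison of functions,
`hasImPolyGrowth_comp_expMap_iff`. For forms, membership in the generated algebra becomes a growth
condition on the components in a frame (`generatedOn_coordForm_iff`, `isLogFormInCoords_iff`). The
image of the constant frame upstairs depends on `z` only, because the derivative of `exp` is a
multiple of `exp`, so the components upstairs are pulled back from below
(`formHasImPolyGrowth_iff`).

What remains is geometric. Log estimates are local near each point of the chart, while those
upstairs concern a whole product of punctured discs; compactness of a smaller closed polydisc over a
point of `K` passes from the former to the latter. Conversely, each point has a product neighborhood
on which only the coordinates in `S` vanishing at that point matter, and the remaining elements of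
`S` are restored by `IsLogFormInCoords.mono_finset`. -/

namespace LogForms

/-! ### Wirtinger derivatives and their compositions along lists. -/

section Wirtinger

variable {d : ℕ}

/-- The underlying coordinate of the index of `dz_i` or `dz̄_i`. -/
def idx (b : Fin d ⊕ Fin d) : Fin d := Sum.elim id id b

/-- The Wirtinger functional: the value of a covector on `∂/∂z_i` (index `inl i`) or on `∂/∂z̄_i`
(index `inr i`). -/
noncomputable def wirtinger : Fin d ⊕ Fin d → (Cd d →L[ℝ] ℂ) → ℂ
  | .inl i, L => (1 / 2 : ℂ) * (L (Pi.single i 1) - Complex.I * L (Pi.single i Complex.I))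
  | .inr i, L => (1 / 2 : ℂ) * (L (Pi.single i 1) + Complex.I * L (Pi.single i Complex.I))

/-- The Wirtinger derivatives `∂/∂z_i` (index `inl i`) and `∂/∂z̄_i` (index `inr i`). -/
noncomputable def wd (b : Fin d ⊕ Fin d) (f : Cd d → ℂ) : Cd d → ℂ :=
  fun z => wirtinger b (fderiv ℝ f z)

theorem wirtinger_add (b : Fin d ⊕ Fin d) (L L' : Cd d →L[ℝ] ℂ) :
    wirtinger b (L + L') = wirtinger b L + wirtinger b L' := by
  cases b <;> simp [wirtinger] <;> ring

theorem wirtinger_smul (b : Fin d ⊕ Fin d) (c : ℂ) (L : Cd d →L[ℝ] ℂ) :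
    wirtinger b (c • L) = c * wirtinger b L := by
  cases b <;> simp [wirtinger] <;> ring

@[simp] theorem wirtinger_zero (b : Fin d ⊕ Fin d) : wirtinger b (0 : Cd d →L[ℝ] ℂ) = 0 := by
  cases b <;> simp [wirtinger]

theorem wirtinger_coordForm (b c : Fin d ⊕ Fin d) :
    wirtinger b (coordForm c) = if b = c then 1 else 0 := by
  rcases b with i | i <;> rcases c with j | j <;> by_cases h : i = j
  all_goals
    first
    | subst h
      simp [wirtinger, coordForm]
      try norm_num
    | simp [wirtinger, coordForm, h, Ne.symm h, eq_comm]

theorem wd_congr {Ω : Set (Cd d)} (hΩ : IsOpen Ω) {f g : Cd d → ℂ} (h : EqOn f g Ω)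
    (b : Fin d ⊕ Fin d) : EqOn (wd b f) (wd b g) Ω := fun z hz => by
  have : f =ᶠ[nhds z] g := Filter.eventuallyEq_of_mem (hΩ.mem_nhds hz) h
  simp [wd, this.fderiv_eq]

theorem contDiffOn_wd {Ω : Set (Cd d)} (hΩ : IsOpen Ω) {f : Cd d → ℂ} (hf : ContDiffOn ℝ ∞ f Ω)
    (b : Fin d ⊕ Fin d) : ContDiffOn ℝ ∞ (wd b f) Ω := by
  have h : ContDiffOn ℝ ∞ (fderiv ℝ f) Ω := hf.fderiv_of_isOpen hΩ (by simp)
  cases b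
  · exact contDiffOn_const.mul ((h.clm_apply contDiffOn_const).sub
      (contDiffOn_const.mul (h.clm_apply contDiffOn_const)))
  · exact contDiffOn_const.mul ((h.clm_apply contDiffOn_const).add
      (contDiffOn_const.mul (h.clm_apply contDiffOn_const)))

theorem _root_.ContDiffOn.differentiableAt_of_isOpen {Ω : Set (Cd d)} (hΩ : IsOpen Ω)
    {f : Cd d → ℂ} (hf : ContDiffOn ℝ ∞ f Ω) {z : Cd d} (hz : z ∈ Ω) : DifferentiableAt ℝ f z :=
  (hf.differentiableOn (by simp)).differentiableAt (hΩ.mem_nhds hz)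

theorem wd_add {f g : Cd d → ℂ} {z : Cd d} (hf : DifferentiableAt ℝ f z)
    (hg : DifferentiableAt ℝ g z) (b : Fin d ⊕ Fin d) :
    wd b (fun z => f z + g z) z = wd b f z + wd b g z := by
  simp only [wd]
  rw [fderiv_fun_add hf hg, wirtinger_add]

theorem wd_mul {f g : Cd d → ℂ} {z : Cd d} (hf : DifferentiableAt ℝ f z)
    (hg : DifferentiableAt ℝ g z) (b : Fin d ⊕ Fin d) :
    wd b (fun z => f z * g z) z = f z * wd b g z + wd b f z * g z := by
  simp only [wd]
  rw [fderiv_fun_mul hf hg, wirtinger_add, wirtinger_smul, wirtinger_smul]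
  ring

theorem wd_const (c : ℂ) (b : Fin d ⊕ Fin d) (z : Cd d) : wd b (fun _ => c) z = 0 := by
  simp [wd]

theorem wd_const_mul {f : Cd d → ℂ} {z : Cd d} (hf : DifferentiableAt ℝ f z) (c : ℂ)
    (b : Fin d ⊕ Fin d) : wd b (fun z => c * f z) z = c * wd b f z := by
  rw [wd_mul (differentiableAt_const c) hf, wd_const]
  ring

theorem wd_coordForm (b c : Fin d ⊕ Fin d) (z : Cd d) :
    wd b (fun z => coordForm c z) z = if b = c then 1 else 0 := by
  rw [← wirtinger_coordForm b c, wd, ContinuousLinearMap.fderiv]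

theorem wd_comm {Ω : Set (Cd d)} (hΩ : IsOpen Ω) {f : Cd d → ℂ} (hf : ContDiffOn ℝ ∞ f Ω)
    (b c : Fin d ⊕ Fin d) : EqOn (wd b (wd c f)) (wd c (wd b f)) Ω := fun z hz => by
  have h : ContDiffOn ℝ ∞ (fderiv ℝ f) Ω := hf.fderiv_of_isOpen hΩ (by simp)
  have hd : DifferentiableAt ℝ (fderiv ℝ f) z :=
    (h.differentiableOn (by simp)).differentiableAt (hΩ.mem_nhds hz)
  have hs : IsSymmSndFDerivAt ℝ f z :=
    (hf.contDiffAt (hΩ.mem_nhds hz)).isSymmSndFDerivAt (by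
      simpa using (WithTop.coe_le_coe.2 le_top : ((2 : ℕ∞) : WithTop ℕ∞) ≤ ((⊤ : ℕ∞) : WithTop ℕ∞)))
  have key (v : Cd d) : HasFDerivAt (fun y => fderiv ℝ f y v) ((fderiv ℝ (fderiv ℝ f) z).flip v) z := by
    refine (hd.hasFDerivAt.clm_apply (hasFDerivAt_const v z)).congr_fderiv ?_
    ext w
    simp
  have e (c : Fin d ⊕ Fin d) (v : Cd d) : fderiv ℝ (wd c f) z v =
      wirtinger c (fderiv ℝ (fderiv ℝ f) z v) := by
    rcases c with i | i
    · have h : HasFDerivAt (wd (.inl i) f) _ z :=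
        ((key (Pi.single i 1)).sub ((key (Pi.single i Complex.I)).const_mul Complex.I)).const_mul
          (1 / 2 : ℂ)
      rw [h.fderiv]
      simp [wirtinger]
    · have h : HasFDerivAt (wd (.inr i) f) _ z :=
        ((key (Pi.single i 1)).add ((key (Pi.single i Complex.I)).const_mul Complex.I)).const_mul
          (1 / 2 : ℂ)
      rw [h.fderiv]
      simp [wirtinger, mul_add]
  rcases b with i | i <;> rcases c with j | j <;>
  · simp only [wd, wirtinger]
    have e1 := e (.inl i)
    have e2 := e (.inl j)
    have e3 := e (.inr i)
    have e4 := e (.inr j)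
    simp only [wirtinger] at e1 e2 e3 e4
    simp only [e1, e2, e3, e4]
    rw [hs (Pi.single i 1) (Pi.single j 1), hs (Pi.single i Complex.I) (Pi.single j 1),
      hs (Pi.single i 1) (Pi.single j Complex.I),
      hs (Pi.single i Complex.I) (Pi.single j Complex.I)]
    ring

/-- The operators `T b`, for `b` in the list `l`, applied successively to `f`. -/
def words (T : Fin d ⊕ Fin d → (Cd d → ℂ) → Cd d → ℂ) : List (Fin d ⊕ Fin d) →
    (Cd d → ℂ) → Cd d → ℂ
  | [], f => f
  | b :: l, f => words T l (T b f)

theorem words_append (T : Fin d ⊕ Fin d → (Cd d → ℂ) → Cd d → ℂ) (l l' : List (Fin d ⊕ Fin d))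
    (f : Cd d → ℂ) : words T (l ++ l') f = words T l' (words T l f) := by
  induction l generalizing f with
  | nil => rfl
  | cons b l ih => exact ih _

theorem words_replicate (T : Fin d ⊕ Fin d → (Cd d → ℂ) → Cd d → ℂ) (k : ℕ) (b : Fin d ⊕ Fin d)
    (f : Cd d → ℂ) : words T (List.replicate k b) f = (T b)^[k] f := by
  induction k generalizing f with
  | zero => rfl
  | succ k ih => exact ih _

theorem words_congr {T : Fin d ⊕ Fin d → (Cd d → ℂ) → Cd d → ℂ} {Ω : Set (Cd d)}
    (hT : ∀ b f g, EqOn f g Ω → EqOn (T b f) (T b g) Ω) (l : List (Fin d ⊕ Fin d))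
    {f g : Cd d → ℂ} (h : EqOn f g Ω) : EqOn (words T l f) (words T l g) Ω := by
  induction l generalizing f g with
  | nil => exact h
  | cons b l ih => exact ih (hT b f g h)

/-- Mixed derivatives commute, so only the multiplicities in the list matter. This lets lists, which
suit induction on one operator at a time, stand in for pairs of multi-indices. -/
theorem words_wd_perm {Ω : Set (Cd d)} (hΩ : IsOpen Ω) {l l' : List (Fin d ⊕ Fin d)}
    (h : l.Perm l') {f : Cd d → ℂ} (hf : ContDiffOn ℝ ∞ f Ω) :
    EqOn (words wd l f) (words wd l' f) Ω := by
  induction h generalizing f with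
  | nil => exact fun _ _ => rfl
  | cons b _ ih => exact ih (contDiffOn_wd hΩ hf b)
  | swap b c l => exact words_congr (fun b _ _ h => wd_congr hΩ h b) l (wd_comm hΩ hf b c)
  | trans _ _ ih ih' => exact (ih hf).trans (ih' hf)

instance : LawfulBEq (Fin d ⊕ Fin d) where
  eq_of_beq {b c} h := by
    rcases b with i | i <;> rcases c with j | j
    · exact congrArg Sum.inl (eq_of_beq (α := Fin d) h)
    · exact absurd h Bool.false_ne_true
    · exact absurd h Bool.false_ne_true
    · exact congrArg Sum.inr (eq_of_beq (α := Fin d) h)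
  rfl {b} := by
    rcases b with i | i
    · exact beq_self_eq_true i
    · exact beq_self_eq_true i

theorem exists_words_foldr (e : Fin d → Fin d ⊕ Fin d) (he : Function.Injective e)
    (α : Fin d → ℕ) (L : List (Fin d)) (hL : L.Nodup) :
    ∃ l : List (Fin d ⊕ Fin d), (∀ f : Cd d → ℂ,
      words wd l f = L.foldr (fun i g => (wd (e i))^[α i] g) f) ∧
      (∀ i, l.count (e i) = if i ∈ L then α i else 0) ∧ ∀ b, b ∉ range e → l.count b = 0 := by
  induction L with
  | nil => exact ⟨[], fun f => rfl, by simp, by simp⟩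
  | cons i L ih =>
    obtain ⟨l, h1, h2, h3⟩ := ih hL.of_cons
    refine ⟨l ++ List.replicate (α i) (e i), fun f => ?_, fun j => ?_, fun b hb => ?_⟩
    · rw [words_append, words_replicate, h1]
      rfl
    · rw [List.count_append, h2, List.count_replicate]
      by_cases hij : j = i
      · subst hij
        simp [(List.nodup_cons.1 hL).1]
      · simp [hij, he.eq_iff, Ne.symm hij]
    · rw [List.count_append, h3 b hb, List.count_replicate]
      have : e i ≠ b := fun h => hb ⟨i, h⟩
      simp [this]

/-- The iterated derivative `∂^α ∂̄^β` is the composition of a list of Wirtinger derivatives. -/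
theorem exists_words_iterPartial (α β : Fin d → ℕ) :
    ∃ l : List (Fin d ⊕ Fin d), (∀ f : Cd d → ℂ,
      words wd l f = iterPartialZ α (iterPartialZbar β f)) ∧
      (∀ i, l.count (.inl i) = α i) ∧ ∀ i, l.count (.inr i) = β i := by
  obtain ⟨l, h1, h2, h3⟩ := exists_words_foldr .inl Sum.inl_injective α _ (List.nodup_finRange d)
  obtain ⟨m, k1, k2, k3⟩ := exists_words_foldr .inr Sum.inr_injective β _ (List.nodup_finRange d)
  refine ⟨m ++ l, fun f => ?_, fun i => ?_, fun i => ?_⟩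
  · rw [words_append, h1, k1]
    rfl
  · rw [List.count_append, h2, k3 _ (by simp)]
    simp
  · rw [List.count_append, k2, h3 _ (by simp)]
    simp

theorem exists_iterPartial_eq_words (l : List (Fin d ⊕ Fin d)) {Ω : Set (Cd d)} (hΩ : IsOpen Ω)
    {f : Cd d → ℂ} (hf : ContDiffOn ℝ ∞ f Ω) :
    EqOn (words wd l f) (iterPartialZ (fun i => l.count (.inl i))
      (iterPartialZbar (fun i => l.count (.inr i)) f)) Ω := by
  obtain ⟨m, h1, h2, h3⟩ := exists_words_iterPartial (fun i : Fin d => l.count (.inl i))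
    (fun i => l.count (.inr i))
  rw [← h1]
  refine words_wd_perm hΩ (List.perm_iff_count.2 ?_) hf
  rintro (i | i)
  · exact (h2 i).symm
  · exact (h3 i).symm

end Wirtinger

end LogForms

namespace LogForms

/-! ### Weighted growth classes; ordinary versus logarithmic derivatives. -/

section Growth

variable {d : ℕ}

/-- On `Ω`, the function `f` is bounded by a polynomial in `Λ`. -/
def Tempered (Λ : Cd d → ℝ) (Ω : Set (Cd d)) (f : Cd d → ℂ) : Prop :=
  ∃ C : ℝ, 0 < C ∧ ∃ N : ℕ, ∀ z ∈ Ω, ‖f z‖ ≤ C * Λ z ^ N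

variable {Λ : Cd d → ℝ} {Ω : Set (Cd d)}

theorem Tempered.mono {f g : Cd d → ℂ} (hf : Tempered Λ Ω f) (h : ∀ z ∈ Ω, ‖g z‖ ≤ ‖f z‖) :
    Tempered Λ Ω g := by
  obtain ⟨C, hC, N, hN⟩ := hf
  exact ⟨C, hC, N, fun z hz => (h z hz).trans (hN z hz)⟩

theorem Tempered.congr {f g : Cd d → ℂ} (hf : Tempered Λ Ω f) (h : ∀ z ∈ Ω, g z = f z) :
    Tempered Λ Ω g :=
  hf.mono fun z hz => by rw [h z hz]

theorem Tempered.add (hΛ : ∀ z ∈ Ω, 1 ≤ Λ z) {f g : Cd d → ℂ} (hf : Tempered Λ Ω f)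
    (hg : Tempered Λ Ω g) : Tempered Λ Ω fun z => f z + g z := by
  obtain ⟨C, hC, N, hN⟩ := hf
  obtain ⟨C', hC', N', hN'⟩ := hg
  refine ⟨C + C', by positivity, max N N', fun z hz => (norm_add_le _ _).trans ?_⟩
  rw [add_mul]
  refine add_le_add ((hN z hz).trans ?_) ((hN' z hz).trans ?_)
  · exact mul_le_mul_of_nonneg_left (pow_le_pow_right₀ (hΛ z hz) (le_max_left _ _)) hC.le
  · exact mul_le_mul_of_nonneg_left (pow_le_pow_right₀ (hΛ z hz) (le_max_right _ _)) hC'.le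

theorem Tempered.const_mul {f : Cd d → ℂ} (hf : Tempered Λ Ω f) (c : ℂ) :
    Tempered Λ Ω fun z => c * f z := by
  obtain ⟨C, hC, N, hN⟩ := hf
  refine ⟨(‖c‖ + 1) * C, by positivity, N, fun z hz => ?_⟩
  rw [norm_mul, mul_assoc]
  exact mul_le_mul (by linarith) (hN z hz) (norm_nonneg _) (by positivity)

theorem Tempered.union {Ω' : Set (Cd d)} (hΛ : ∀ z ∈ Ω ∪ Ω', 1 ≤ Λ z) {f : Cd d → ℂ}
    (hf : Tempered Λ Ω f) (hg : Tempered Λ Ω' f) : Tempered Λ (Ω ∪ Ω') f := by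
  obtain ⟨C, hC, N, hN⟩ := hf
  obtain ⟨C', hC', N', hN'⟩ := hg
  refine ⟨max C C', by positivity, max N N', ?_⟩
  rintro z (hz | hz)
  · refine (hN z hz).trans (mul_le_mul (le_max_left _ _)
      (pow_le_pow_right₀ (hΛ z (.inl hz)) (le_max_left _ _)) ?_ (by positivity))
    exact pow_nonneg (zero_le_one.trans (hΛ z (.inl hz))) _
  · refine (hN' z hz).trans (mul_le_mul (le_max_right _ _)
      (pow_le_pow_right₀ (hΛ z (.inr hz)) (le_max_right _ _)) ?_ (by positivity))
    exact pow_nonneg (zero_le_one.trans (hΛ z (.inr hz))) _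

/-- A family of linear differential operators on the smooth functions on `Ω`. -/
structure IsDiffOpFamily (T : Fin d ⊕ Fin d → (Cd d → ℂ) → Cd d → ℂ) (Ω : Set (Cd d)) : Prop where
  congr : ∀ b f g, EqOn f g Ω → EqOn (T b f) (T b g) Ω
  contDiffOn : ∀ b f, ContDiffOn ℝ ∞ f Ω → ContDiffOn ℝ ∞ (T b f) Ω
  add : ∀ b f g, ContDiffOn ℝ ∞ f Ω → ContDiffOn ℝ ∞ g Ω →
    EqOn (T b fun z => f z + g z) (fun z => T b f z + T b g z) Ω
  const_mul : ∀ b (c : ℂ) f, ContDiffOn ℝ ∞ f Ω →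
    EqOn (T b fun z => c * f z) (fun z => c * T b f z) Ω

variable {T : Fin d ⊕ Fin d → (Cd d → ℂ) → Cd d → ℂ}

theorem IsDiffOpFamily.words_add (hT : IsDiffOpFamily T Ω) (l : List (Fin d ⊕ Fin d))
    {f g : Cd d → ℂ} (hf : ContDiffOn ℝ ∞ f Ω) (hg : ContDiffOn ℝ ∞ g Ω) :
    EqOn (words T l fun z => f z + g z) (fun z => words T l f z + words T l g z) Ω := by
  induction l generalizing f g with
  | nil => exact fun _ _ => rfl
  | cons b l ih =>
    exact (words_congr hT.congr l (hT.add b f g hf hg)).trans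
      (ih (hT.contDiffOn b f hf) (hT.contDiffOn b g hg))

theorem IsDiffOpFamily.words_const_mul (hT : IsDiffOpFamily T Ω) (l : List (Fin d ⊕ Fin d))
    (c : ℂ) {f : Cd d → ℂ} (hf : ContDiffOn ℝ ∞ f Ω) :
    EqOn (words T l fun z => c * f z) (fun z => c * words T l f z) Ω := by
  induction l generalizing f with
  | nil => exact fun _ _ => rfl
  | cons b l ih =>
    exact (words_congr hT.congr l (hT.const_mul b c f hf)).trans (ih (hT.contDiffOn b f hf))

theorem isDiffOpFamily_wd (hΩ : IsOpen Ω) : IsDiffOpFamily wd Ω where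
  congr b _ _ h := wd_congr hΩ h b
  contDiffOn b _ h := contDiffOn_wd hΩ h b
  add b _ _ hf hg _ hz :=
    wd_add (hf.differentiableAt_of_isOpen hΩ hz) (hg.differentiableAt_of_isOpen hΩ hz) b
  const_mul b c _ hf _ hz := wd_const_mul (hf.differentiableAt_of_isOpen hΩ hz) c b

/-- `f` is smooth on `Ω`, and all the functions obtained from it by the operators `T b` are
bounded by a polynomial in `Λ` when weighted by `u` and by one factor `w b` for each operator. -/
def GrowthClass (T : Fin d ⊕ Fin d → (Cd d → ℂ) → Cd d → ℂ) (w : Fin d ⊕ Fin d → Cd d → ℂ)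
    (Λ : Cd d → ℝ) (Ω : Set (Cd d)) (u f : Cd d → ℂ) : Prop :=
  ContDiffOn ℝ ∞ f Ω ∧
    ∀ l, Tempered Λ Ω fun z => u z * (l.map fun b => w b z).prod * words T l f z

variable {w : Fin d ⊕ Fin d → Cd d → ℂ} {u f g : Cd d → ℂ}

theorem GrowthClass.congr (hT : IsDiffOpFamily T Ω) (hf : GrowthClass T w Λ Ω u f)
    (h : EqOn g f Ω) : GrowthClass T w Λ Ω u g :=
  ⟨hf.1.congr h, fun l => (hf.2 l).congr fun z hz => by
    simp only [words_congr hT.congr l h hz]⟩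

theorem GrowthClass.mono_weight {v : Cd d → ℂ} (hf : GrowthClass T w Λ Ω u f)
    (h : ∀ z ∈ Ω, ‖v z‖ ≤ ‖u z‖) : GrowthClass T w Λ Ω v f :=
  ⟨hf.1, fun l => (hf.2 l).mono fun z hz => by
    simp only [norm_mul]
    gcongr
    exact h z hz⟩

theorem GrowthClass.add (hT : IsDiffOpFamily T Ω) (hΛ : ∀ z ∈ Ω, 1 ≤ Λ z)
    (hf : GrowthClass T w Λ Ω u f) (hg : GrowthClass T w Λ Ω u g) :
    GrowthClass T w Λ Ω u fun z => f z + g z :=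
  ⟨hf.1.add hg.1, fun l => ((hf.2 l).add hΛ (hg.2 l)).congr fun z hz => by
    simp only [hT.words_add l hf.1 hg.1 hz]
    ring⟩

theorem GrowthClass.const_mul (hT : IsDiffOpFamily T Ω) (hf : GrowthClass T w Λ Ω u f) (c : ℂ) :
    GrowthClass T w Λ Ω u fun z => c * f z :=
  ⟨contDiffOn_const.mul hf.1, fun l => ((hf.2 l).const_mul c).congr fun z hz => by
    simp only [hT.words_const_mul l c hf.1 hz]
    ring⟩

theorem growthClass_zero (hT : IsDiffOpFamily T Ω) :
    GrowthClass T w Λ Ω u fun _ => 0 := by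
  refine ⟨contDiffOn_const, fun l => ⟨1, one_pos, 0, fun z hz => ?_⟩⟩
  have := hT.words_const_mul l 0 (contDiffOn_const (c := (0 : ℂ))) hz
  simp only [mul_zero, zero_mul] at this
  simp [this]

theorem growthClass_sum {ι : Type*} (hT : IsDiffOpFamily T Ω) (hΛ : ∀ z ∈ Ω, 1 ≤ Λ z)
    (s : Finset ι) {F : ι → Cd d → ℂ} (hF : ∀ i ∈ s, GrowthClass T w Λ Ω u (F i)) :
    GrowthClass T w Λ Ω u fun z => ∑ i ∈ s, F i z := by
  classical
  induction s using Finset.induction_on with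
  | empty => simpa using growthClass_zero hT
  | insert a s ha ih =>
    simp only [Finset.sum_insert ha]
    exact (hF a (by simp)).add hT hΛ (ih fun i hi => hF i (by simp [hi]))

/-- The factor belonging to the first operator of each list moves into the fixed weight. The weight
`u` is carried along to make such inductions possible. -/
theorem GrowthClass.apply (hT : IsDiffOpFamily T Ω) (hf : GrowthClass T w Λ Ω u f)
    (b : Fin d ⊕ Fin d) : GrowthClass T w Λ Ω (fun z => u z * w b z) (T b f) :=
  ⟨hT.contDiffOn b f hf.1, fun l => (hf.2 (b :: l)).congr fun z hz => by
    simp only [List.map_cons, List.prod_cons, words]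
    ring⟩

theorem GrowthClass.union {Ω' : Set (Cd d)} (hΩ : IsOpen Ω) (hΩ' : IsOpen Ω')
    (hΛ : ∀ z ∈ Ω ∪ Ω', 1 ≤ Λ z) (hf : GrowthClass T w Λ Ω u f)
    (hg : GrowthClass T w Λ Ω' u f) : GrowthClass T w Λ (Ω ∪ Ω') u f :=
  ⟨hf.1.union_of_isOpen hg.1 hΩ hΩ', fun l => (hf.2 l).union hΛ (hg.2 l)⟩

theorem GrowthClass.mono {Ω' : Set (Cd d)} (hf : GrowthClass T w Λ Ω u f) (h : Ω' ⊆ Ω) :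
    GrowthClass T w Λ Ω' u f :=
  ⟨hf.1.mono h, fun l => by
    obtain ⟨C, hC, N, hN⟩ := hf.2 l
    exact ⟨C, hC, N, fun z hz => hN z (h hz)⟩⟩

/-- The factor `z_i` or `z̄_i` for `i ∈ S`, and `1` for `i ∉ S`. -/
noncomputable def logCoord (S : Finset (Fin d)) (b : Fin d ⊕ Fin d) (z : Cd d) : ℂ :=
  if idx b ∈ S then coordForm b z else 1

/-- The logarithmic derivatives `z_i ∂/∂z_i` and `z̄_i ∂/∂z̄_i` for `i ∈ S`, and the Wirtinger
derivatives for `i ∉ S`. -/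
noncomputable def logWd (S : Finset (Fin d)) (b : Fin d ⊕ Fin d) (f : Cd d → ℂ) : Cd d → ℂ :=
  fun z => logCoord S b z * wd b f z

variable (S : Finset (Fin d))

theorem contDiff_logCoord (b : Fin d ⊕ Fin d) : ContDiff ℝ ∞ (logCoord S b) := by
  by_cases h : idx b ∈ S
  · have : logCoord S b = fun z => coordForm b z := by
      ext z
      simp [logCoord, h]
    rw [this]
    exact (coordForm b).contDiff
  · have : logCoord S b = fun _ => 1 := by
      ext z
      simp [logCoord, h]
    rw [this]
    exact contDiff_const

theorem wd_logCoord (b c : Fin d ⊕ Fin d) (z : Cd d) :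
    wd b (logCoord S c) z = if b = c ∧ idx c ∈ S then 1 else 0 := by
  by_cases h : idx c ∈ S
  · have : logCoord S c = fun z => coordForm c z := by
      ext z
      simp [logCoord, h]
    rw [this, wd_coordForm]
    simp [h]
  · have : logCoord S c = fun _ => 1 := by
      ext z
      simp [logCoord, h]
    rw [this, wd_const]
    simp [h]

theorem isDiffOpFamily_logWd (hΩ : IsOpen Ω) : IsDiffOpFamily (logWd S) Ω where
  congr b _ _ h z hz := by simp only [logWd, wd_congr hΩ h b hz]
  contDiffOn b _ h := (contDiff_logCoord S b).contDiffOn.mul (contDiffOn_wd hΩ h b)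
  add b _ _ hf hg _ hz := by
    simp only [logWd]
    rw [wd_add (hf.differentiableAt_of_isOpen hΩ hz) (hg.differentiableAt_of_isOpen hΩ hz) b,
      mul_add]
  const_mul b c _ hf _ hz := by
    simp only [logWd]
    rw [wd_const_mul (hf.differentiableAt_of_isOpen hΩ hz) c b]
    ring

variable {S}

/-- By Leibniz, `∂_b (z_c f)` is `z_c ∂_b f` plus `f` when `b = c`. The first term is handled by
induction on the list, with `f` and the weight varying. -/
theorem GrowthClass.logCoord_mul (hΩ : IsOpen Ω) (hΛ : ∀ z ∈ Ω, 1 ≤ Λ z) (c : Fin d ⊕ Fin d)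
    (hf : GrowthClass wd (logCoord S) Λ Ω (fun z => u z * logCoord S c z) f) :
    GrowthClass wd (logCoord S) Λ Ω u fun z => logCoord S c z * f z := by
  have hT := isDiffOpFamily_wd hΩ
  refine ⟨(contDiff_logCoord S c).contDiffOn.mul hf.1, fun l => ?_⟩
  induction l generalizing u f with
  | nil =>
    refine (hf.2 []).congr fun z hz => ?_
    simp only [words, List.map_nil, List.prod_nil]
    ring
  | cons b l ih =>
    have hb : GrowthClass wd (logCoord S) Λ Ω
        (fun z => (u z * logCoord S b z) * logCoord S c z) (wd b f) :=
      (hf.apply hT b).mono_weight fun z _ => le_of_eq (congrArg norm (by ring))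
    have h1 := ih hb
    have hs : ContDiffOn ℝ ∞ (fun z => logCoord S c z * wd b f z) Ω :=
      (contDiff_logCoord S c).contDiffOn.mul hb.1
    by_cases hbc : b = c ∧ idx c ∈ S
    · have e : EqOn (wd b fun z => logCoord S c z * f z)
          (fun z => logCoord S c z * wd b f z + f z) Ω := fun z hz => by
        rw [wd_mul ((contDiff_logCoord S c).contDiffOn.differentiableAt_of_isOpen hΩ hz)
          (hf.1.differentiableAt_of_isOpen hΩ hz), wd_logCoord, if_pos hbc, one_mul]
      -- The extra term `f` has one derivative less but still carries the factor of `b`; as `b = c`,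
      -- this is exactly the weight in the hypothesis on `f`.
      refine (h1.add hΛ (hf.2 l)).congr fun z hz => ?_
      simp only [words, List.map_cons, List.prod_cons]
      rw [words_congr hT.congr l e hz, hT.words_add l hs hf.1 hz, hbc.1]
      ring
    · have e : EqOn (wd b fun z => logCoord S c z * f z)
          (fun z => logCoord S c z * wd b f z) Ω := fun z hz => by
        rw [wd_mul ((contDiff_logCoord S c).contDiffOn.differentiableAt_of_isOpen hΩ hz)
          (hf.1.differentiableAt_of_isOpen hΩ hz), wd_logCoord, if_neg hbc, zero_mul, add_zero]
      refine h1.congr fun z hz => ?_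
      simp only [words, List.map_cons, List.prod_cons]
      rw [words_congr hT.congr l e hz]
      ring

theorem logWd_logCoord_inv_mul (hΩ : IsOpen Ω) (b c : Fin d ⊕ Fin d)
    (h0 : ∀ z ∈ Ω, logCoord S c z ≠ 0) (hf : ContDiffOn ℝ ∞ f Ω) :
    EqOn (logWd S b fun z => (logCoord S c z)⁻¹ * f z)
      (fun z => (logCoord S c z)⁻¹ *
        (logWd S b f z + (if b = c ∧ idx c ∈ S then -1 else 0) * f z)) Ω := fun z hz => by
  have hc := (contDiff_logCoord S c).contDiffOn (s := Ω)
  have hg : ContDiffOn ℝ ∞ (fun z => (logCoord S c z)⁻¹ * f z) Ω := (hc.inv h0).mul hf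
  have e : EqOn f (fun z => logCoord S c z * ((logCoord S c z)⁻¹ * f z)) Ω := fun y hy => by
    simp only
    rw [mul_inv_cancel_left₀ (h0 y hy)]
  -- Differentiating `f = z_c (z_c⁻¹ f)` by the product rule and solving avoids differentiating the
  -- inverse.
  have h1 := wd_congr hΩ e b hz
  rw [wd_mul (hc.differentiableAt_of_isOpen hΩ hz) (hg.differentiableAt_of_isOpen hΩ hz),
    wd_logCoord] at h1
  have hz0 := h0 z hz
  simp only [logWd]
  rw [h1]
  split_ifs with hbc
  · rw [hbc.1]
    field_simp
    ring
  · field_simp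
    ring

/-- Conjugating a logarithmic derivative by `z_c` changes it by a constant at most, so the inverse
stays in front throughout and is cancelled by the weight. -/
theorem GrowthClass.logCoord_inv_mul (hΩ : IsOpen Ω) (hΛ : ∀ z ∈ Ω, 1 ≤ Λ z) (c : Fin d ⊕ Fin d)
    (h0 : ∀ z ∈ Ω, logCoord S c z ≠ 0) (hf : GrowthClass (logWd S) 1 Λ Ω u f) :
    GrowthClass (logWd S) 1 Λ Ω (fun z => u z * logCoord S c z)
      fun z => (logCoord S c z)⁻¹ * f z := by
  have hT := isDiffOpFamily_logWd S hΩ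
  refine ⟨((contDiff_logCoord S c).contDiffOn.inv h0).mul hf.1, fun l => ?_⟩
  induction l generalizing f with
  | nil =>
    refine (hf.2 []).congr fun z hz => ?_
    have := h0 z hz
    simp only [words, List.map_nil, List.prod_nil]
    field_simp
  | cons b l ih =>
    have hb : GrowthClass (logWd S) 1 Λ Ω u (logWd S b f) := by
      simpa using hf.apply hT b
    refine (ih (hb.add hT hΛ (hf.const_mul hT (if b = c ∧ idx c ∈ S then -1 else 0)))).congr
      fun z hz => ?_
    simp only [words]
    rw [words_congr hT.congr l (logWd_logCoord_inv_mul hΩ b c h0 hf.1) hz]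
    simp

theorem growthClass_wd_iff_logWd (hΩ : IsOpen Ω) (hΛ : ∀ z ∈ Ω, 1 ≤ Λ z)
    (h0 : ∀ c, ∀ z ∈ Ω, logCoord S c z ≠ 0) :
    GrowthClass wd (logCoord S) Λ Ω 1 f ↔ GrowthClass (logWd S) 1 Λ Ω 1 f := by
  constructor
  · intro hf
    refine ⟨hf.1, fun l => ?_⟩
    induction l generalizing f with
    | nil => exact hf.2 []
    | cons b l ih =>
      have hb : GrowthClass wd (logCoord S) Λ Ω 1 (logWd S b f) :=
        (hf.apply (isDiffOpFamily_wd hΩ) b).logCoord_mul hΩ hΛ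
      refine (ih hb).congr fun z hz => ?_
      simp [words]
  · intro hf
    refine ⟨hf.1, fun l => ?_⟩
    -- Each rewriting of `∂_b` as `z_b⁻¹ (z_b ∂_b)` puts one more factor `z_b` into the weight, so
    -- the induction needs an arbitrary weight.
    generalize (1 : Cd d → ℂ) = v at hf
    induction l generalizing f v with
    | nil => exact hf.2 []
    | cons b l ih =>
      have hb : GrowthClass (logWd S) 1 Λ Ω v (logWd S b f) := by
        simpa using hf.apply (isDiffOpFamily_logWd S hΩ) b
      have h2 := (hb.logCoord_inv_mul hΩ hΛ b (h0 b)).congr (isDiffOpFamily_logWd S hΩ)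
        (g := wd b f) fun z hz => by
          have := h0 b z hz
          simp only [logWd]
          field_simp
      refine (ih _ h2).congr fun z hz => ?_
      simp only [words, List.map_cons, List.prod_cons]
      ring

end Growth

end LogForms

namespace LogForms

/-! ### Growth conditions as growth classes, and their behavior under the exponential map. -/

section Comparison

variable {d : ℕ} {S : Finset (Fin d)} {Ω : Set (Cd d)} {f : Cd d → ℂ}

/-- The product of the `log (1 / |z_i|)` for `i ∈ S`. -/
noncomputable def logProd (S : Finset (Fin d)) (z : Cd d) : ℝ :=
  |∏ i ∈ S, Real.log (1 / ‖z i‖)|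

/-- The product of the imaginary parts of the `x_i` for `i ∈ S`. -/
def imProd (S : Finset (Fin d)) (x : Cd d) : ℝ := |∏ i ∈ S, (x i).im|

theorem norm_coordForm (b : Fin d ⊕ Fin d) (z : Cd d) : ‖coordForm b z‖ = ‖z (idx b)‖ := by
  cases b <;> simp [coordForm, idx]

theorem norm_prod_logCoord (S : Finset (Fin d)) (l : List (Fin d ⊕ Fin d)) (z : Cd d) :
    ‖(l.map fun b => logCoord S b z).prod‖ =
      ∏ i ∈ S, ‖z i‖ ^ (l.count (.inl i) + l.count (.inr i)) := by
  induction l with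
  | nil => simp
  | cons b l ih =>
    have h : ‖logCoord S b z‖ = ∏ i ∈ S, ‖z i‖ ^ (if idx b = i then 1 else 0) := by
      by_cases h : idx b ∈ S
      · simp [logCoord, h, norm_coordForm, pow_ite]
      · simp [logCoord, h, pow_ite]
    rw [List.map_cons, List.prod_cons, norm_mul, ih, h, ← Finset.prod_mul_distrib]
    refine Finset.prod_congr rfl fun i _ => ?_
    rw [← pow_add]
    congr 1
    rcases b with j | j
    · by_cases hj : j = i
      · subst hj
        simp [idx]
        ring
      · simp [idx, hj]
    · by_cases hj : j = i
      · subst hj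
        simp [idx]
        ring
      · simp [idx, hj]

/-- There are finitely many multi-indices of bounded order. Hence exponents chosen separately for
each derivative can be made to depend on the order only, as both growth definitions require. -/
theorem exists_bound_of_order_le (N : (Fin d → ℕ) → (Fin d → ℕ) → ℕ) (K : ℕ) :
    ∃ M, ∀ α β, order α + order β ≤ K → N α β ≤ M := by
  have hfin : {p : (Fin d → ℕ) × (Fin d → ℕ) | order p.1 + order p.2 ≤ K}.Finite := by
    refine ((Set.finite_Iic (fun _ : Fin d => K)).prod (Set.finite_Iic fun _ => K)).subset ?_
    rintro ⟨α, β⟩ h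
    have hα (i : Fin d) : α i ≤ order α := Finset.single_le_sum (fun _ _ => Nat.zero_le _)
      (Finset.mem_univ i)
    have hβ (i : Fin d) : β i ≤ order β := Finset.single_le_sum (fun _ _ => Nat.zero_le _)
      (Finset.mem_univ i)
    replace h : order α + order β ≤ K := h
    exact ⟨fun i => by simp only; linarith [hα i], fun i => by simp only; linarith [hβ i]⟩
  obtain ⟨M, hM⟩ := (hfin.image fun p => N p.1 p.2).bddAbove
  exact ⟨M, fun α β h => hM ⟨(α, β), h, rfl⟩⟩

theorem mul_zpow_le_mul_pow_toNat {C Λ : ℝ} (hC : 0 ≤ C) (hΛ : 1 ≤ Λ) (N : ℤ) :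
    C * Λ ^ N ≤ C * Λ ^ N.toNat := by
  rw [← zpow_natCast]
  exact mul_le_mul_of_nonneg_left (zpow_le_zpow_right₀ hΛ N.self_le_toNat) hC

/-- The weights of a list multiply to the denominator of the definition. Since `logProd` is at least
`1`, exponents may be enlarged freely, in particular from integers to natural numbers. -/
theorem hasLogGrowth_iff (hΩ : IsOpen Ω) (hΛ : ∀ z ∈ Ω, 1 ≤ logProd S z)
    (h0 : ∀ z ∈ Ω, ∀ i ∈ S, z i ≠ 0) :
    HasLogGrowth S Ω f ↔ GrowthClass wd (logCoord S) (logProd S) Ω 1 f := by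
  have hpos (γ : Fin d → ℕ) (z) (hz : z ∈ Ω) : 0 < ∏ i ∈ S, ‖z i‖ ^ γ i :=
    Finset.prod_pos fun i hi => pow_pos (norm_pos_iff.2 (h0 z hz i hi)) _
  constructor
  · intro h
    refine ⟨(h 0).1, fun l => ?_⟩
    obtain ⟨N, hN⟩ := (h (order (fun i => l.count (.inl i)) + order fun i => l.count (.inr i))).2
    obtain ⟨C, hC, hb⟩ := hN _ _ le_rfl
    refine ⟨C, hC, N.toNat, fun z hz => ?_⟩
    have hp := hpos (fun i => l.count (.inl i) + l.count (.inr i)) z hz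
    simp only [Pi.one_apply, one_mul, norm_mul]
    rw [norm_prod_logCoord,
      exists_iterPartial_eq_words l hΩ (h 0).1 hz]
    refine (mul_le_mul_of_nonneg_left (hb z hz) hp.le).trans
      (le_trans (le_of_eq ?_) (mul_zpow_le_mul_pow_toNat hC.le (hΛ z hz) N))
    simp only [logProd] at hp ⊢
    field_simp
  · rintro ⟨hs, h⟩ K
    have h' (α β : Fin d → ℕ) : ∃ N : ℕ, ∃ C : ℝ, 0 < C ∧ ∀ z ∈ Ω,
        ‖iterPartialZ α (iterPartialZbar β f) z‖ ≤
          C * (logProd S z ^ N / ∏ i ∈ S, ‖z i‖ ^ (α i + β i)) := by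
      obtain ⟨l, h1, h2, h3⟩ := exists_words_iterPartial α β
      obtain ⟨C, hC, N, hN⟩ := h l
      refine ⟨N, C, hC, fun z hz => ?_⟩
      have hp := hpos (fun i => α i + β i) z hz
      have := hN z hz
      simp only [Pi.one_apply, one_mul, norm_mul] at this
      rw [norm_prod_logCoord, h1] at this
      simp only [h2, h3] at this
      rw [← mul_div_assoc, le_div_iff₀ hp, mul_comm]
      exact this
    choose N hN using h'
    obtain ⟨M, hM⟩ := exists_bound_of_order_le N K
    refine ⟨hs, M, fun α β hαβ => ?_⟩
    obtain ⟨C, hC, hb⟩ := hN α β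
    refine ⟨C, hC, fun z hz => (hb z hz).trans (mul_le_mul_of_nonneg_left ?_ hC.le)⟩
    have hp := hpos (fun i => α i + β i) z hz
    rw [zpow_natCast]
    exact div_le_div_of_nonneg_right (pow_le_pow_right₀ (hΛ z hz) (hM α β hαβ)) hp.le

theorem hasImPolyGrowth_iff (hΩ : IsOpen Ω) (hΛ : ∀ x ∈ Ω, 1 ≤ imProd S x) :
    HasImPolyGrowth S Ω f ↔ GrowthClass wd 1 (imProd S) Ω 1 f := by
  constructor
  · rintro ⟨hs, N, hN⟩
    refine ⟨hs, fun l => ?_⟩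
    obtain ⟨C, hC, hb⟩ := hN (fun i => l.count (.inl i)) (fun i => l.count (.inr i))
    refine ⟨C, hC, Int.toNat (N (order (fun i => l.count (.inl i)) +
      order fun i => l.count (.inr i))), fun x hx => ?_⟩
    have := (hb x hx).trans (mul_zpow_le_mul_pow_toNat hC.le (hΛ x hx) _)
    simpa [exists_iterPartial_eq_words l hΩ hs hx] using this
  · rintro ⟨hs, h⟩
    have h' (α β : Fin d → ℕ) : ∃ N : ℕ, ∃ C : ℝ, 0 < C ∧ ∀ x ∈ Ω,
        ‖iterPartialZ α (iterPartialZbar β f) x‖ ≤ C * imProd S x ^ N := by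
      obtain ⟨l, h1, h2, h3⟩ := exists_words_iterPartial α β
      obtain ⟨C, hC, N, hN⟩ := h l
      exact ⟨N, C, hC, fun x hx => by simpa [h1] using hN x hx⟩
    choose N hN using h'
    choose M hM using exists_bound_of_order_le N
    refine ⟨hs, fun m => M m, fun α β => ?_⟩
    obtain ⟨C, hC, hb⟩ := hN α β
    refine ⟨C, hC, fun x hx => (hb x hx).trans (mul_le_mul_of_nonneg_left ?_ hC.le)⟩
    rw [zpow_natCast]
    exact pow_le_pow_right₀ (hΛ x hx) (hM _ α β le_rfl)

/-- The derivative of `expMap S` at a point over `z`. -/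
noncomputable def expDeriv (S : Finset (Fin d)) (z : Cd d) : Cd d →L[ℂ] Cd d :=
  ContinuousLinearMap.pi fun i =>
    (if i ∈ S then 2 * Real.pi * Complex.I * z i else 1) • ContinuousLinearMap.proj i

theorem hasFDerivAt_expMap (S : Finset (Fin d)) (x : Cd d) :
    HasFDerivAt (expMap S) (expDeriv S (expMap S x)) x := by
  refine hasFDerivAt_pi.2 fun i => ?_
  by_cases h : i ∈ S
  · have h1 : HasFDerivAt (fun x : Cd d => 2 * Real.pi * Complex.I * x i)
        ((2 * Real.pi * Complex.I : ℂ) • (ContinuousLinearMap.proj i : Cd d →L[ℂ] ℂ)) x :=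
      (hasFDerivAt_apply i x).const_mul _
    have h2 := h1.cexp
    simp only [expMap, h, if_true]
    refine h2.congr_fderiv ?_
    rw [smul_smul, mul_comm]
  · simp only [expMap, h, if_false, one_smul]
    exact hasFDerivAt_apply i x

theorem contDiff_expMap (S : Finset (Fin d)) : ContDiff ℝ ∞ (expMap S) := by
  refine contDiff_pi.2 fun i => ?_
  by_cases h : i ∈ S
  · simp only [expMap, h, if_true]
    exact (contDiff_const.mul (contDiff_apply ℝ ℂ i)).cexp
  · simp only [expMap, h, if_false]
    exact contDiff_apply ℝ ℂ i

/-- The constants by which logarithmic forms and derivatives change under `expMap S`. -/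
noncomputable def expConst (S : Finset (Fin d)) : Fin d ⊕ Fin d → ℂ
  | .inl i => if i ∈ S then 2 * Real.pi * Complex.I else 1
  | .inr i => if i ∈ S then -(2 * Real.pi * Complex.I) else 1

theorem expConst_ne_zero (S : Finset (Fin d)) (b : Fin d ⊕ Fin d) : expConst S b ≠ 0 := by
  rcases b with i | i <;> by_cases h : i ∈ S <;>
    simp [expConst, h, Real.pi_ne_zero, Complex.I_ne_zero]

theorem map_single_eq (L : Cd d →L[ℝ] ℂ) (i : Fin d) (w : ℂ) :
    L (Pi.single i w) = w.re * L (Pi.single i 1) + w.im * L (Pi.single i Complex.I) := by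
  have h : (Pi.single i w : Cd d) = w.re • (Pi.single i 1 : Cd d) + w.im • (Pi.single i Complex.I : Cd d) := by
    rw [← Pi.single_smul, ← Pi.single_smul, ← Pi.single_add]
    congr 1
    simp [Complex.re_add_im]
  rw [h, map_add, map_smul, map_smul]
  simp

theorem expDeriv_apply (S : Finset (Fin d)) (z v : Cd d) (i : Fin d) :
    expDeriv S z v i = (if i ∈ S then 2 * Real.pi * Complex.I * z i else 1) * v i := rfl

theorem expDeriv_single (S : Finset (Fin d)) (z : Cd d) (i : Fin d) (w : ℂ) :
    expDeriv S z (Pi.single i w) =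
      Pi.single i ((if i ∈ S then 2 * Real.pi * Complex.I * z i else 1) * w) := by
  ext j
  rw [expDeriv_apply]
  by_cases hj : j = i
  · subst hj
    rw [Pi.single_eq_same, Pi.single_eq_same]
  · rw [Pi.single_eq_of_ne hj, Pi.single_eq_of_ne hj, mul_zero]

/-- The chain rule for a complex-linear map acting on the `i`-th axis by `w`: `∂/∂z_i` is multiplied
by `w`, and `∂/∂z̄_i` (in `wirtinger_inr_single`) by its conjugate. -/
theorem wirtinger_inl_single (L : Cd d →L[ℝ] ℂ) (i : Fin d) (w : ℂ) :
    (1 / 2 : ℂ) * (L (Pi.single i (w * 1)) - Complex.I * L (Pi.single i (w * Complex.I))) =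
      w * wirtinger (.inl i) L := by
  rw [map_single_eq L i (w * 1), map_single_eq L i (w * Complex.I), wirtinger]
  -- The fifth occurrence is the factor `w` on the right-hand side.
  nth_rewrite 5 [← Complex.re_add_im w]
  simp only [mul_one, Complex.mul_re, Complex.mul_im, Complex.I_re, Complex.I_im, mul_zero]
  push_cast
  linear_combination ((1 / 2) * w.im * L (Pi.single i Complex.I)) * Complex.I_sq

theorem wirtinger_inr_single (L : Cd d →L[ℝ] ℂ) (i : Fin d) (w : ℂ) :
    (1 / 2 : ℂ) * (L (Pi.single i (w * 1)) + Complex.I * L (Pi.single i (w * Complex.I))) =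
      starRingEnd ℂ w * wirtinger (.inr i) L := by
  rw [map_single_eq L i (w * 1), map_single_eq L i (w * Complex.I), wirtinger]
  have h : starRingEnd ℂ w = w.re - w.im * Complex.I := by
    apply Complex.ext <;> simp
  rw [h]
  simp only [mul_one, Complex.mul_re, Complex.mul_im, Complex.I_re, Complex.I_im, mul_zero]
  push_cast
  linear_combination ((1 / 2) * w.im * L (Pi.single i Complex.I)) * Complex.I_sq

theorem wirtinger_comp_expDeriv (S : Finset (Fin d)) (z : Cd d) (L : Cd d →L[ℝ] ℂ)
    (b : Fin d ⊕ Fin d) :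
    wirtinger b (L.comp ((expDeriv S z).restrictScalars ℝ)) =
      expConst S b * (logCoord S b z * wirtinger b L) := by
  rcases b with i | i
  · rw [wirtinger]
    simp only [ContinuousLinearMap.comp_apply, ContinuousLinearMap.coe_restrictScalars',
      expDeriv_single]
    rw [wirtinger_inl_single, ← mul_assoc]
    by_cases h : i ∈ S <;> simp [h, expConst, logCoord, idx, coordForm]
  · rw [wirtinger]
    simp only [ContinuousLinearMap.comp_apply, ContinuousLinearMap.coe_restrictScalars',
      expDeriv_single]
    rw [wirtinger_inr_single, ← mul_assoc]
    have h2 : starRingEnd ℂ 2 = 2 := map_ofNat _ 2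
    by_cases h : i ∈ S <;> simp [h, expConst, logCoord, idx, coordForm, h2]

theorem wd_comp_expMap (S : Finset (Fin d)) {f : Cd d → ℂ} {x : Cd d}
    (hf : DifferentiableAt ℝ f (expMap S x)) (b : Fin d ⊕ Fin d) :
    wd b (f ∘ expMap S) x = expConst S b * logWd S b f (expMap S x) := by
  have h := hf.hasFDerivAt.comp x ((hasFDerivAt_expMap S x).restrictScalars ℝ)
  rw [wd, h.fderiv, wirtinger_comp_expDeriv]
  rfl

theorem words_comp_expMap (hΩ : IsOpen Ω) (hf : ContDiffOn ℝ ∞ f Ω) (l : List (Fin d ⊕ Fin d)) :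
    EqOn (words wd l (f ∘ expMap S))
      (fun x => (l.map (expConst S)).prod * words (logWd S) l f (expMap S x))
      (expMap S ⁻¹' Ω) := by
  have hO : IsOpen (expMap S ⁻¹' Ω) := hΩ.preimage (contDiff_expMap S).continuous
  have hT := isDiffOpFamily_wd hO
  induction l generalizing f with
  | nil => exact fun x _ => by simp [words]
  | cons b l ih =>
    intro x hx
    have e : EqOn (wd b (f ∘ expMap S)) (fun x => expConst S b * (logWd S b f ∘ expMap S) x)
        (expMap S ⁻¹' Ω) := fun y hy => wd_comp_expMap S (hf.differentiableAt_of_isOpen hΩ hy) b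
    have hs : ContDiffOn ℝ ∞ (logWd S b f) Ω := (isDiffOpFamily_logWd S hΩ).contDiffOn b f hf
    have hs' : ContDiffOn ℝ ∞ (logWd S b f ∘ expMap S) (expMap S ⁻¹' Ω) :=
      hs.comp (contDiff_expMap S).contDiffOn (mapsTo_preimage _ _)
    rw [words, words_congr hT.congr l e hx, hT.words_const_mul l _ hs' hx]
    simp only [ih hs hx, List.map_cons, List.prod_cons, words]
    ring

theorem norm_expMap {i : Fin d} (hi : i ∈ S) (x : Cd d) :
    ‖expMap S x i‖ = Real.exp (-(2 * Real.pi * (x i).im)) := by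
  simp only [expMap, hi, if_true, Complex.norm_exp]
  congr 1
  simp

theorem logProd_expMap (S : Finset (Fin d)) (x : Cd d) :
    logProd S (expMap S x) = (2 * Real.pi) ^ S.card * imProd S x := by
  have : ∏ i ∈ S, Real.log (1 / ‖expMap S x i‖) = (2 * Real.pi) ^ S.card * ∏ i ∈ S, (x i).im := by
    rw [← Finset.prod_const, ← Finset.prod_mul_distrib]
    refine Finset.prod_congr rfl fun i hi => ?_
    rw [norm_expMap hi, one_div, ← Real.exp_neg, neg_neg, Real.log_exp]
  rw [logProd, this, abs_mul, imProd, abs_of_nonneg (by positivity)]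

/-- The two size functions differ by the constant `(2π)^|S|`. Bounds descend because every point of
`Ω` has a preimage in `Ω'`. -/
theorem tempered_comp_expMap_iff {Ω' : Set (Cd d)} (hΩ : Ω = expMap S '' Ω')
    (g : Cd d → ℂ) :
    Tempered (imProd S) Ω' (g ∘ expMap S) ↔ Tempered (logProd S) Ω g := by
  subst hΩ
  constructor
  · rintro ⟨C, hC, N, hN⟩
    refine ⟨C * ((2 * Real.pi) ^ S.card)⁻¹ ^ N, by positivity, N, ?_⟩
    rintro _ ⟨x, hx, rfl⟩
    refine (hN x hx).trans (le_of_eq ?_)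
    have hP : (2 * Real.pi) ^ S.card ≠ 0 := by positivity
    rw [logProd_expMap]
    generalize (2 * Real.pi) ^ S.card = P at hP
    rw [mul_pow, mul_assoc, ← mul_assoc (P⁻¹ ^ N), ← mul_pow, inv_mul_cancel₀ hP, one_pow,
      one_mul]
  · rintro ⟨C, hC, N, hN⟩
    refine ⟨C * ((2 * Real.pi) ^ S.card) ^ N, by positivity, N, fun x hx => ?_⟩
    refine (hN _ ⟨x, hx, rfl⟩).trans (le_of_eq ?_)
    rw [logProd_expMap, mul_pow, mul_assoc]

theorem logCoord_ne_zero {z : Cd d} (h : ∀ i ∈ S, z i ≠ 0) (c : Fin d ⊕ Fin d) :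
    logCoord S c z ≠ 0 := by
  unfold logCoord
  split_ifs with hc
  · rw [← norm_ne_zero_iff, norm_coordForm, norm_ne_zero_iff]
    exact h _ hc
  · exact one_ne_zero

theorem expMap_ne_zero (x : Cd d) {i : Fin d} (hi : i ∈ S) : expMap S x i ≠ 0 := by
  simp [expMap, hi]

/-- A function has logarithmic growth if and only if its composition with the exponential map
has imaginary polynomial growth. -/
theorem hasImPolyGrowth_comp_expMap_iff {Ω' : Set (Cd d)} (hΩ : Ω = expMap S '' Ω')
    (hΩo : IsOpen Ω) (hΩo' : IsOpen Ω') (hΛ : ∀ z ∈ Ω, 1 ≤ logProd S z)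
    (hΛ' : ∀ x ∈ Ω', 1 ≤ imProd S x) (hf : ContDiffOn ℝ ∞ f Ω) :
    HasImPolyGrowth S Ω' (f ∘ expMap S) ↔ HasLogGrowth S Ω f := by
  have h0 : ∀ z ∈ Ω, ∀ i ∈ S, z i ≠ 0 := by
    subst hΩ
    rintro _ ⟨x, hx, rfl⟩ i hi
    exact expMap_ne_zero x hi
  have hm : MapsTo (expMap S) Ω' Ω := hΩ ▸ mapsTo_image _ _
  rw [hasLogGrowth_iff hΩo hΛ h0, hasImPolyGrowth_iff hΩo' hΛ',
    growthClass_wd_iff_logWd hΩo hΛ fun c z hz => logCoord_ne_zero (h0 z hz) c]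
  have hs : ContDiffOn ℝ ∞ (f ∘ expMap S) Ω' := hf.comp (contDiff_expMap S).contDiffOn hm
  have key (l : List (Fin d ⊕ Fin d)) :
      (Tempered (imProd S) Ω' fun x => (1 : Cd d → ℂ) x *
        (l.map fun b => (1 : Fin d ⊕ Fin d → Cd d → ℂ) b x).prod * words wd l (f ∘ expMap S) x) ↔
      Tempered (logProd S) Ω fun x => (1 : Cd d → ℂ) x *
        (l.map fun b => (1 : Fin d ⊕ Fin d → Cd d → ℂ) b x).prod * words (logWd S) l f x := by
    rw [← tempered_comp_expMap_iff hΩ]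
    have hc : (l.map (expConst S)).prod ≠ 0 := by
      refine List.prod_ne_zero ?_
      simp [expConst_ne_zero]
    constructor
    · intro h
      refine (h.const_mul (l.map (expConst S)).prod⁻¹).congr fun x hx => ?_
      simp [words_comp_expMap hΩo hf l (hm hx), hc]
    · intro h
      refine (h.const_mul (l.map (expConst S)).prod).congr fun x hx => ?_
      simp [words_comp_expMap hΩo hf l (hm hx)]
  exact ⟨fun h => ⟨hf, fun l => (key l).1 (h.2 l)⟩, fun h => ⟨hs, fun l => (key l).2 (h.2 l)⟩⟩

end Comparison

end LogForms

namespace LogForms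

/-! ### Components of alternating forms in constant and logarithmic frames. -/

section LinearAlgebra

variable {d n : ℕ}

/-- The real frame of `ℂ^d` made of the vectors `∂/∂x_i` (index `inl i`) and `∂/∂y_i`
(index `inr i`). -/
noncomputable def frameVec : Fin d ⊕ Fin d → Cd d
  | .inl i => Pi.single i 1
  | .inr i => Pi.single i Complex.I

/-- The real coordinates with respect to `frameVec`. -/
noncomputable def frameCoord : Fin d ⊕ Fin d → (Cd d →L[ℝ] ℝ)
  | .inl i => Complex.reCLM.comp (ContinuousLinearMap.proj i)
  | .inr i => Complex.imCLM.comp (ContinuousLinearMap.proj i)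

theorem sum_frameCoord_smul_frameVec (v : Cd d) : ∑ b, frameCoord b v • frameVec b = v := by
  rw [Fintype.sum_sum_type, ← Finset.sum_add_distrib]
  have h (i : Fin d) : frameCoord (.inl i) v • (frameVec (.inl i) : Cd d) +
      frameCoord (.inr i) v • frameVec (.inr i) = Pi.single i (v i) := by
    simp only [frameCoord, frameVec]
    rw [← Pi.single_smul, ← Pi.single_smul, ← Pi.single_add]
    congr 1
    simp [Complex.re_add_im]
  simp only [h]
  exact Finset.univ_sum_single v

theorem apply_eq_sum_frame (θ : Cd d [⋀^Fin n]→L[ℝ] ℂ) (v : Fin n → Cd d) :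
    θ v = ∑ c : Fin n → Fin d ⊕ Fin d,
      (∏ j, (frameCoord (c j) (v j) : ℂ)) * θ fun j => frameVec (c j) := by
  conv_lhs => rw [show v = fun j => ∑ b, frameCoord b (v j) • frameVec b from
    funext fun j => (sum_frameCoord_smul_frameVec (v j)).symm]
  rw [θ.map_sum]
  refine Finset.sum_congr rfl fun c _ => ?_
  rw [θ.map_smul_univ (fun j => frameCoord (c j) (v j)) fun j => frameVec (c j)]
  simp

/-- Each permutation in the determinant contributes the multilinear expansion of `θ (v ∘ σ)` times
the sign, that is `θ v`. Summing over all index maps, not only increasing ones, costs the factor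
`n!`. -/
theorem factorial_mul_apply_eq_sum_det (θ : Cd d [⋀^Fin n]→L[ℝ] ℂ) (v : Fin n → Cd d) :
    (n.factorial : ℂ) * θ v = ∑ c : Fin n → Fin d ⊕ Fin d, (θ fun j => frameVec (c j)) *
      (Matrix.of fun i j : Fin n => (frameCoord (c j) (v i) : ℂ)).det := by
  simp only [Matrix.det_apply, Finset.mul_sum]
  rw [Finset.sum_comm]
  have h (σ : Equiv.Perm (Fin n)) : ∑ c : Fin n → Fin d ⊕ Fin d, (θ fun j => frameVec (c j)) *
      (Equiv.Perm.sign σ • ∏ i, Matrix.of (fun i j : Fin n => (frameCoord (c j) (v i) : ℂ))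
        (σ i) i) = θ v := by
    have h1 := apply_eq_sum_frame θ (v ∘ σ)
    have h2 : θ (v ∘ σ) = Equiv.Perm.sign σ • θ v := θ.toAlternatingMap.map_perm v σ
    have h3 : θ v = Equiv.Perm.sign σ • θ (v ∘ σ) := by
      rw [h2, smul_smul, Int.units_mul_self, one_smul]
    rw [h3, h1, Finset.smul_sum]
    refine Finset.sum_congr rfl fun c _ => ?_
    simp only [Matrix.of_apply, Function.comp_apply, Units.smul_def, zsmul_eq_mul]
    ring
  refine Eq.symm ((Finset.sum_congr rfl fun σ _ => h σ).trans ?_)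
  simp [Fintype.card_perm]

/-- The coefficients of the real coordinates in the complex coordinates and their conjugates. -/
noncomputable def frameCoeff : Fin d ⊕ Fin d → Fin d ⊕ Fin d → ℂ
  | .inl i, .inl j => if i = j then 1 / 2 else 0
  | .inl i, .inr j => if i = j then 1 / 2 else 0
  | .inr i, .inl j => if i = j then -Complex.I / 2 else 0
  | .inr i, .inr j => if i = j then Complex.I / 2 else 0

theorem frameCoord_eq_sum (b : Fin d ⊕ Fin d) (v : Cd d) :
    (frameCoord b v : ℂ) = ∑ t, frameCoeff b t * coordForm t v := by
  rw [Fintype.sum_sum_type]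
  rcases b with i | i
  · simp [frameCoeff, frameCoord, coordForm, Complex.re_eq_add_conj]
    ring
  · simp [frameCoeff, frameCoord, coordForm, Complex.im_eq_sub_conj]
    field_simp
    rw [Complex.I_sq]
    ring

theorem det_frameCoord (c : Fin n → Fin d ⊕ Fin d) (v : Fin n → Cd d) :
    (Matrix.of fun i j : Fin n => (frameCoord (c j) (v i) : ℂ)).det =
      ∑ a : Fin n → Fin d ⊕ Fin d, (∏ j, frameCoeff (c j) (a j)) *
        (Matrix.of fun i j : Fin n => coordForm (a j) (v i)).det := by
  simp only [Matrix.det_apply, Finset.mul_sum]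
  rw [Finset.sum_comm]
  refine Finset.sum_congr rfl fun σ _ => ?_
  simp only [Matrix.of_apply, frameCoord_eq_sum]
  rw [Finset.prod_univ_sum, Fintype.piFinset_univ, Finset.smul_sum]
  refine Finset.sum_congr rfl fun a _ => ?_
  rw [Finset.prod_mul_distrib]
  simp only [Units.smul_def, zsmul_eq_mul]
  ring

/-- The closure properties of a class of functions under which the coefficients of a form may be
taken with respect to any constant frame. -/
structure IsLinearClass (Ω : Set (Cd d)) (P : (Cd d → ℂ) → Prop) : Prop where
  congr : ∀ f g, P f → EqOn g f Ω → P g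
  const_mul : ∀ f (c : ℂ), P f → P fun z => c * f z
  sum : ∀ F : (Fin n → Fin d ⊕ Fin d) → Cd d → ℂ, (∀ a, P (F a)) → P fun z => ∑ a, F a z

theorem generatedOn_coordForm_iff {Ω : Set (Cd d)} {P : (Cd d → ℂ) → Prop}
    (hP : IsLinearClass (n := n) Ω P) (θ : Cd d → (Cd d [⋀^Fin n]→L[ℝ] ℂ)) :
    GeneratedOn P (fun _ => coordForm) Ω θ ↔
      ∀ b : Fin n → Fin d ⊕ Fin d, P fun z => θ z fun j => frameVec (b j) := by
  constructor
  · rintro ⟨c, hc, h⟩ b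
    refine hP.congr _ _ (hP.sum (fun a z => (Matrix.of fun i j : Fin n =>
      coordForm (a j) (frameVec (b i))).det * c a z) fun a => hP.const_mul _ _ (hc a))
      fun z hz => ?_
    simp only [h z hz, mul_comm]
  · intro h
    -- The coefficients come from the determinant expansion in the real frame, rewritten in `dz_i`,
    -- `dz̄_i` and divided by `n!`.
    refine ⟨fun a z => (n.factorial : ℂ)⁻¹ * ∑ c : Fin n → Fin d ⊕ Fin d,
      (∏ j, frameCoeff (c j) (a j)) * θ z fun j => frameVec (c j),
      fun a => hP.const_mul _ _ (hP.sum _ fun c => hP.const_mul _ _ (h c)), fun z _ v => ?_⟩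
    have hn : (n.factorial : ℂ) ≠ 0 := by exact_mod_cast n.factorial_ne_zero
    rw [← mul_right_inj' hn, factorial_mul_apply_eq_sum_det, Finset.mul_sum]
    simp only [det_frameCoord, Finset.mul_sum, Finset.sum_mul]
    rw [Finset.sum_comm]
    refine Finset.sum_congr rfl fun a _ => Finset.sum_congr rfl fun c _ => ?_
    field_simp

theorem coordForm_expDeriv (S : Finset (Fin d)) {z : Cd d} (h0 : ∀ i ∈ S, z i ≠ 0)
    (b : Fin d ⊕ Fin d) (v : Cd d) :
    logCoordForm S z b (expDeriv S z v) = expConst S b * coordForm b v := by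
  rcases b with i | i <;> by_cases h : i ∈ S
  · have := h0 i h
    simp only [logCoordForm, h, if_true, coordForm, expConst, smul_apply,
      ContinuousLinearMap.proj_apply, expDeriv_apply, smul_eq_mul]
    field_simp
  · simp [logCoordForm, h, coordForm, expConst, expDeriv_apply]
  · have : starRingEnd ℂ (z i) ≠ 0 := by simpa using h0 i h
    have h2 : starRingEnd ℂ 2 = 2 := map_ofNat _ 2
    simp [logCoordForm, h, coordForm, expConst, expDeriv_apply, h2]
    field_simp
  · simp [logCoordForm, h, coordForm, expConst, expDeriv_apply]

theorem det_logCoordForm_expDeriv (S : Finset (Fin d)) {z : Cd d} (h0 : ∀ i ∈ S, z i ≠ 0)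
    (a : Fin n → Fin d ⊕ Fin d) (v : Fin n → Cd d) :
    (Matrix.of fun i j : Fin n => logCoordForm S z (a j) (expDeriv S z (v i))).det =
      (∏ j, expConst S (a j)) * (Matrix.of fun i j : Fin n => coordForm (a j) (v i)).det := by
  simp only [coordForm_expDeriv S h0]
  exact Matrix.det_mul_row _ _

theorem expDeriv_surjective (S : Finset (Fin d)) {z : Cd d} (h0 : ∀ i ∈ S, z i ≠ 0) :
    Function.Surjective (expDeriv S z) := fun v => by
  refine ⟨fun i => (if i ∈ S then 2 * Real.pi * Complex.I * z i else 1)⁻¹ * v i, ?_⟩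
  ext i
  rw [expDeriv_apply, mul_inv_cancel_left₀]
  split_ifs with h
  · simp [h0 i h, Real.pi_ne_zero]
  · exact one_ne_zero

/-- Composition with `expDeriv S z` turns logarithmic covectors into constant multiples of
coordinate ones. It is surjective off the hyperplanes, so no information on the form is lost. -/
theorem generatedOn_logCoordForm_iff {S : Finset (Fin d)} {Ω : Set (Cd d)}
    (h0 : ∀ z ∈ Ω, ∀ i ∈ S, z i ≠ 0) {P : (Cd d → ℂ) → Prop} (hP : IsLinearClass (n := n) Ω P)
    (θ : Cd d → (Cd d [⋀^Fin n]→L[ℝ] ℂ)) :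
    GeneratedOn P (logCoordForm S) Ω θ ↔ GeneratedOn P (fun _ => coordForm) Ω fun z =>
      (θ z).compContinuousLinearMap ((expDeriv S z).restrictScalars ℝ) := by
  constructor
  · rintro ⟨c, hc, h⟩
    refine ⟨fun a z => (∏ j, expConst S (a j)) * c a z, fun a => hP.const_mul _ _ (hc a),
      fun z hz v => (h z hz _).trans (Finset.sum_congr rfl fun a _ => ?_)⟩
    refine (congrArg (c a z * ·) (det_logCoordForm_expDeriv S (h0 z hz) a v)).trans ?_
    ring
  · rintro ⟨c, hc, h⟩
    refine ⟨fun a z => (∏ j, expConst S (a j))⁻¹ * c a z, fun a => hP.const_mul _ _ (hc a),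
      fun z hz v => ?_⟩
    choose w hw using fun i => expDeriv_surjective S (h0 z hz) (v i)
    obtain rfl : (fun i => expDeriv S z (w i)) = v := funext hw
    refine (h z hz w).trans (Finset.sum_congr rfl fun a _ => ?_)
    have hk : ∏ j, expConst S (a j) ≠ 0 := Finset.prod_ne_zero_iff.2 fun j _ =>
      expConst_ne_zero S _
    rw [det_logCoordForm_expDeriv S (h0 z hz)]
    field_simp

/-- The components of a form in the frame of the vector fields `expDeriv S z (frameVec b)`. -/
noncomputable def logComponent (S : Finset (Fin d)) (θ : Cd d → (Cd d [⋀^Fin n]→L[ℝ] ℂ))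
    (b : Fin n → Fin d ⊕ Fin d) (z : Cd d) : ℂ :=
  θ z fun j => expDeriv S z (frameVec (b j))

theorem contDiff_expDeriv_apply (S : Finset (Fin d)) (v : Cd d) :
    ContDiff ℝ ∞ fun z => expDeriv S z v := by
  refine contDiff_pi.2 fun i => ?_
  by_cases h : i ∈ S
  · simp only [expDeriv_apply, h, if_true]
    exact (contDiff_const.mul (contDiff_apply ℝ ℂ i)).mul contDiff_const
  · simp only [expDeriv_apply, h, if_false]
    exact contDiff_const

theorem contDiffOn_logComponent (S : Finset (Fin d)) {Ω : Set (Cd d)}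
    {θ : Cd d → (Cd d [⋀^Fin n]→L[ℝ] ℂ)} (hθ : ContDiffOn ℝ ∞ θ Ω)
    (b : Fin n → Fin d ⊕ Fin d) : ContDiffOn ℝ ∞ (logComponent S θ b) Ω := by
  -- The frame vectors vary with `z`; expanding them in the constant frame separates their
  -- smoothness from that of `θ`.
  have e : logComponent S θ b = fun z => ∑ c : Fin n → Fin d ⊕ Fin d,
      (∏ j, (frameCoord (c j) (expDeriv S z (frameVec (b j))) : ℂ)) *
        θ z fun j => frameVec (c j) := funext fun z => apply_eq_sum_frame _ _
  rw [e]
  refine ContDiffOn.sum fun c _ => ContDiffOn.mul ?_ ?_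
  · refine (contDiff_prod fun j _ => ?_).contDiffOn
    exact Complex.ofRealCLM.contDiff.comp
      ((frameCoord (c j)).contDiff.comp (contDiff_expDeriv_apply S _))
  · exact (ContinuousAlternatingMap.apply ℝ (Cd d) ℂ fun j => frameVec (c j)).contDiff.comp_contDiffOn
      hθ

end LinearAlgebra

end LogForms

namespace LogForms

/-! ### Closure properties of the growth conditions; enlarging `S`. -/

section LinearClasses

variable {d n : ℕ} {S : Finset (Fin d)} {Ω : Set (Cd d)}

theorem isLinearClass_hasLogGrowth (hΩ : IsOpen Ω) (hΛ : ∀ z ∈ Ω, 1 ≤ logProd S z)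
    (h0 : ∀ z ∈ Ω, ∀ i ∈ S, z i ≠ 0) : IsLinearClass (n := n) Ω (HasLogGrowth S Ω) where
  congr f g := by
    simp only [hasLogGrowth_iff hΩ hΛ h0]
    exact fun h => h.congr (isDiffOpFamily_wd hΩ)
  const_mul f c := by
    simp only [hasLogGrowth_iff hΩ hΛ h0]
    exact fun h => h.const_mul (isDiffOpFamily_wd hΩ) c
  sum F := by
    simp only [hasLogGrowth_iff hΩ hΛ h0]
    exact fun h => growthClass_sum (isDiffOpFamily_wd hΩ) hΛ _ fun i _ => h i

theorem isLinearClass_hasImPolyGrowth (hΩ : IsOpen Ω) (hΛ : ∀ x ∈ Ω, 1 ≤ imProd S x) :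
    IsLinearClass (n := n) Ω (HasImPolyGrowth S Ω) where
  congr f g := by
    simp only [hasImPolyGrowth_iff hΩ hΛ]
    exact fun h => h.congr (isDiffOpFamily_wd hΩ)
  const_mul f c := by
    simp only [hasImPolyGrowth_iff hΩ hΛ]
    exact fun h => h.const_mul (isDiffOpFamily_wd hΩ) c
  sum F := by
    simp only [hasImPolyGrowth_iff hΩ hΛ]
    exact fun h => growthClass_sum (isDiffOpFamily_wd hΩ) hΛ _ fun i _ => h i

theorem isLogFormInCoords_iff (hΩ : IsOpen Ω) (hΛ : ∀ z ∈ Ω, 1 ≤ logProd S z)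
    (h0 : ∀ z ∈ Ω, ∀ i ∈ S, z i ≠ 0) (θ : Cd d → (Cd d [⋀^Fin n]→L[ℝ] ℂ)) :
    IsLogFormInCoords S Ω θ ↔ ∀ b, HasLogGrowth S Ω (logComponent S θ b) := by
  have hP := isLinearClass_hasLogGrowth (n := n) hΩ hΛ h0
  rw [IsLogFormInCoords, generatedOn_logCoordForm_iff h0 hP, generatedOn_coordForm_iff hP]
  rfl

theorem HasLogGrowth.mono {Ω' : Set (Cd d)} (hΩ : IsOpen Ω) (hΩ' : IsOpen Ω')
    (hΛ : ∀ z ∈ Ω, 1 ≤ logProd S z) (h0 : ∀ z ∈ Ω, ∀ i ∈ S, z i ≠ 0) {f : Cd d → ℂ}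
    (hf : HasLogGrowth S Ω f) (h : Ω' ⊆ Ω) : HasLogGrowth S Ω' f :=
  (hasLogGrowth_iff hΩ' (fun z hz => hΛ z (h hz)) fun z hz => h0 z (h hz)).2
    (((hasLogGrowth_iff hΩ hΛ h0).1 hf).mono h)

theorem HasLogGrowth.union {Ω' : Set (Cd d)} (hΩ : IsOpen Ω) (hΩ' : IsOpen Ω')
    (hΛ : ∀ z ∈ Ω ∪ Ω', 1 ≤ logProd S z) (h0 : ∀ z ∈ Ω ∪ Ω', ∀ i ∈ S, z i ≠ 0) {f : Cd d → ℂ}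
    (hf : HasLogGrowth S Ω f) (hf' : HasLogGrowth S Ω' f) : HasLogGrowth S (Ω ∪ Ω') f :=
  (hasLogGrowth_iff (hΩ.union hΩ') hΛ h0).2 (GrowthClass.union hΩ hΩ' hΛ
    ((hasLogGrowth_iff hΩ (fun z hz => hΛ z (.inl hz)) fun z hz => h0 z (.inl hz)).1 hf)
    ((hasLogGrowth_iff hΩ' (fun z hz => hΛ z (.inr hz)) fun z hz => h0 z (.inr hz)).1 hf'))

/-- The bound on `w` makes the logarithm at least `e`; the later estimates need only `1`. -/
theorem one_le_log_one_div {w : ℂ} (h0 : w ≠ 0) (h : ‖w‖ ≤ 1 / Real.exp (Real.exp 1)) :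
    1 ≤ Real.log (1 / ‖w‖) := by
  have hw : 0 < ‖w‖ := norm_pos_iff.2 h0
  rw [one_div, Real.log_inv]
  have h1 := Real.log_le_log hw h
  rw [one_div, Real.log_inv, Real.log_exp] at h1
  linarith [Real.add_one_le_exp (1 : ℝ)]

theorem norm_le_one_of_le {w : ℂ} (h : ‖w‖ ≤ 1 / Real.exp (Real.exp 1)) : ‖w‖ ≤ 1 :=
  h.trans (by
    rw [one_div]
    exact inv_le_one_of_one_le₀ (Real.one_le_exp (Real.exp_pos 1).le))

theorem one_le_prod_of_one_le {ι : Type*} {s : Finset ι} {f : ι → ℝ} (h : ∀ i ∈ s, 1 ≤ f i) :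
    1 ≤ ∏ i ∈ s, f i := by
  simpa using Finset.prod_le_prod (f := fun _ => (1 : ℝ)) (fun _ _ => zero_le_one) h

theorem one_le_logProd {z : Cd d} (h0 : ∀ i ∈ S, z i ≠ 0)
    (h : ∀ i, ‖z i‖ ≤ 1 / Real.exp (Real.exp 1)) : 1 ≤ logProd S z := by
  rw [logProd]
  refine le_trans ?_ (le_abs_self _)
  exact one_le_prod_of_one_le fun i hi => one_le_log_one_div (h0 i hi) (h i)

theorem logProd_mono {S' : Finset (Fin d)} (hS : S' ⊆ S) {z : Cd d} (h0 : ∀ i ∈ S, z i ≠ 0)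
    (h : ∀ i, ‖z i‖ ≤ 1 / Real.exp (Real.exp 1)) : logProd S' z ≤ logProd S z := by
  have h1 (i) (hi : i ∈ S) := one_le_log_one_div (h0 i hi) (h i)
  rw [logProd, logProd, abs_of_nonneg, abs_of_nonneg]
  · rw [← Finset.prod_sdiff hS]
    refine le_mul_of_one_le_left
      (Finset.prod_nonneg fun i hi => zero_le_one.trans (h1 i (hS hi))) ?_
    exact one_le_prod_of_one_le fun i hi => h1 i (Finset.sdiff_subset hi)
  · exact Finset.prod_nonneg fun i hi => zero_le_one.trans (h1 i hi)
  · exact Finset.prod_nonneg fun i hi => zero_le_one.trans (h1 i (hS hi))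

theorem norm_logCoord_le_one {z : Cd d} (h : ∀ i, ‖z i‖ ≤ 1 / Real.exp (Real.exp 1))
    (b : Fin d ⊕ Fin d) : ‖logCoord S b z‖ ≤ 1 := by
  unfold logCoord
  split_ifs
  · rw [norm_coordForm]
    exact norm_le_one_of_le (h _)
  · simp

/-- Enlarging the index set only weakens the estimate: the new weights `|z_i|` are at most `1` and
the new logarithms at least `1`. -/
theorem HasLogGrowth.mono_finset {S' : Finset (Fin d)} (hS : S' ⊆ S) (hΩ : IsOpen Ω)
    (h0 : ∀ z ∈ Ω, ∀ i ∈ S, z i ≠ 0) (h : ∀ z ∈ Ω, ∀ i, ‖z i‖ ≤ 1 / Real.exp (Real.exp 1))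
    {f : Cd d → ℂ} (hf : HasLogGrowth S' Ω f) : HasLogGrowth S Ω f := by
  rw [hasLogGrowth_iff hΩ (fun z hz => one_le_logProd (h0 z hz) (h z hz)) h0]
  rw [hasLogGrowth_iff hΩ (fun z hz => one_le_logProd (fun i hi => h0 z hz i (hS hi)) (h z hz))
    fun z hz i hi => h0 z hz i (hS hi)] at hf
  refine ⟨hf.1, fun l => ?_⟩
  obtain ⟨C, hC, N, hN⟩ := hf.2 l
  refine ⟨C, hC, N, fun z hz => ?_⟩
  have h1 : ‖(l.map fun b => logCoord S b z).prod‖ ≤ ‖(l.map fun b => logCoord S' b z).prod‖ := by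
    rw [norm_prod_logCoord, norm_prod_logCoord]
    rw [← Finset.prod_sdiff hS]
    refine mul_le_of_le_one_left (by positivity)
      (Finset.prod_le_one (fun i _ => by positivity) fun i _ => ?_)
    exact pow_le_one₀ (norm_nonneg _) (norm_le_one_of_le (h z hz i))
  refine le_trans ?_ ((hN z hz).trans (mul_le_mul_of_nonneg_left
    (pow_le_pow_left₀ (abs_nonneg _) (logProd_mono hS (h0 z hz) (h z hz)) N) hC.le))
  simp only [norm_mul]
  gcongr

theorem HasLogGrowth.logCoord_mul (hΩ : IsOpen Ω)
    (h0 : ∀ z ∈ Ω, ∀ i ∈ S, z i ≠ 0) (h : ∀ z ∈ Ω, ∀ i, ‖z i‖ ≤ 1 / Real.exp (Real.exp 1))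
    {f : Cd d → ℂ} (hf : HasLogGrowth S Ω f) (b : Fin d ⊕ Fin d) :
    HasLogGrowth S Ω fun z => logCoord S b z * f z := by
  have hΛ (z) (hz : z ∈ Ω) : 1 ≤ logProd S z := one_le_logProd (h0 z hz) (h z hz)
  rw [hasLogGrowth_iff hΩ hΛ h0] at hf ⊢
  refine GrowthClass.logCoord_mul hΩ hΛ b (hf.mono_weight fun z hz => ?_)
  simpa using norm_logCoord_le_one (h z hz) b

theorem logCoordForm_eq {S' : Finset (Fin d)} (hS : S' ⊆ S) {z : Cd d} (h0 : ∀ i ∈ S, z i ≠ 0)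
    (b : Fin d ⊕ Fin d) (v : Cd d) :
    logCoordForm S' z b v = (if idx b ∈ S' then 1 else logCoord S b z) * logCoordForm S z b v := by
  rcases b with i | i <;> by_cases h : i ∈ S <;> by_cases h' : i ∈ S' <;>
    simp_all [logCoordForm, logCoord, idx, coordForm]
  all_goals exact absurd (hS h') h

/-- For `i` in `S` but not in `S'`, write `dz_i = z_i · dz_i/z_i` and move the factor `z_i`, which
preserves logarithmic growth, into the coefficient. -/
theorem IsLogFormInCoords.mono_finset {S' : Finset (Fin d)} (hS : S' ⊆ S) (hΩ : IsOpen Ω)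
    (h0 : ∀ z ∈ Ω, ∀ i ∈ S, z i ≠ 0) (h : ∀ z ∈ Ω, ∀ i, ‖z i‖ ≤ 1 / Real.exp (Real.exp 1))
    {θ : Cd d → (Cd d [⋀^Fin n]→L[ℝ] ℂ)} (hθ : IsLogFormInCoords S' Ω θ) :
    IsLogFormInCoords S Ω θ := by
  obtain ⟨c, hc, hs⟩ := hθ
  refine ⟨fun a z => (∏ j, if idx (a j) ∈ S' then 1 else logCoord S (a j) z) * c a z,
    fun a => ?_, fun z hz v => ?_⟩
  · have hca := (hc a).mono_finset hS hΩ h0 h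
    generalize (Finset.univ : Finset (Fin n)) = s
    induction s using Finset.induction_on with
    | empty => simpa using hca
    | insert j s hj ih =>
      simp only [Finset.prod_insert hj]
      split_ifs
      · simpa using ih
      · simpa only [mul_assoc] using ih.logCoord_mul hΩ h0 h (a j)
  · rw [hs z hz v]
    refine Finset.sum_congr rfl fun a _ => ?_
    simp only [logCoordForm_eq hS (h0 z hz)]
    have := Matrix.det_mul_row (fun j => if idx (a j) ∈ S' then 1 else logCoord S (a j) z)
      (Matrix.of fun i j : Fin n => logCoordForm S z (a j) (v i))
    simp only [Matrix.of_apply] at this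
    rw [this]
    ring

end LinearClasses

end LogForms

namespace LogForms

/-! ### Polydiscs, half-plane products and a tube lemma. -/

section Products

variable {d : ℕ} {S : Finset (Fin d)}

/-- The complement of the coordinate hyperplanes `z_i = 0`, `i ∈ S`. -/
def nonzeroSet (S : Finset (Fin d)) : Set (Cd d) := {z | ∀ i ∈ S, z i ≠ 0}

theorem isOpen_setOf_forall_mem_finset {ι Y : Type*} [TopologicalSpace Y] (s : Finset ι)
    {p : ι → Y → Prop} (h : ∀ i ∈ s, IsOpen {y | p i y}) : IsOpen {y | ∀ i ∈ s, p i y} := by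
  have := isOpen_biInter_finset h
  convert this
  ext y
  simp

theorem isOpen_nonzeroSet (S : Finset (Fin d)) : IsOpen (nonzeroSet S) :=
  isOpen_setOf_forall_mem_finset S fun i _ =>
    isOpen_ne_fun (continuous_apply i) continuous_const

theorem isOpen_discProd (r : ℝ) {K : Set ({i : Fin d // i ∉ S} → ℂ)} (hK : IsOpen K) :
    IsOpen (discProd S r K) :=
  (isOpen_setOf_forall_mem_finset S fun i _ =>
    isOpen_lt (continuous_apply i).norm continuous_const).inter
      (hK.preimage (continuous_pi fun i => continuous_apply i.1))

theorem isOpen_halfPlaneProd (M : ℝ) {K : Set ({i : Fin d // i ∉ S} → ℂ)} (hK : IsOpen K) :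
    IsOpen (halfPlaneProd S M K) :=
  (isOpen_setOf_forall_mem_finset S fun i _ =>
    isOpen_lt continuous_const (Complex.continuous_im.comp (continuous_apply i))).inter
      (hK.preimage (continuous_pi fun i => continuous_apply i.1))

theorem expMap_image_halfPlaneProd (S : Finset (Fin d)) (M : ℝ)
    (K : Set ({i : Fin d // i ∉ S} → ℂ)) :
    expMap S '' halfPlaneProd S M K =
      discProd S (Real.exp (-(2 * Real.pi * M))) K ∩ nonzeroSet S := by
  have hr (x : Cd d) : (fun i : {i : Fin d // i ∉ S} => expMap S x i) =
      fun i : {i : Fin d // i ∉ S} => x i :=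
    funext fun i => by simp [expMap, i.2]
  ext z
  constructor
  · rintro ⟨x, ⟨hx, hK⟩, rfl⟩
    refine ⟨⟨fun i hi => ?_, ?_⟩, fun i hi => expMap_ne_zero x hi⟩
    · rw [norm_expMap hi, Real.exp_lt_exp]
      have := mul_lt_mul_of_pos_left (hx i hi) Real.two_pi_pos
      linarith
    · rw [hr]
      exact hK
  · rintro ⟨⟨hz, hK⟩, h0⟩
    have h2 : (2 * Real.pi * Complex.I : ℂ) ≠ 0 := by
      simp [Real.pi_ne_zero]
    set x : Cd d := fun i => if i ∈ S then Complex.log (z i) / (2 * Real.pi * Complex.I) else z i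
      with hxdef
    have hx : expMap S x = z := by
      ext i
      by_cases hi : i ∈ S
      · simp only [expMap, hxdef, hi, if_true]
        rw [mul_div_cancel₀ _ h2, Complex.exp_log (h0 i hi)]
      · simp [expMap, hxdef, hi]
    refine ⟨x, ⟨fun i hi => ?_, ?_⟩, hx⟩
    · have h := hz i hi
      rw [← hx, norm_expMap hi, Real.exp_lt_exp] at h
      have : 2 * Real.pi * M < 2 * Real.pi * (x i).im := by linarith
      exact lt_of_mul_lt_mul_left this Real.two_pi_pos.le
    · rw [← hr, hx]
      exact hK

theorem one_le_imProd {M : ℝ} (hM : 1 < M) {K : Set ({i : Fin d // i ∉ S} → ℂ)} {x : Cd d}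
    (hx : x ∈ halfPlaneProd S M K) : 1 ≤ imProd S x :=
  (one_le_prod_of_one_le fun i hi => (hM.trans (hx.1 i hi)).le).trans (le_abs_self _)

/-- The image of the half-plane product lies in discs of radius strictly below `r`, so the closed
discs of that radius still fit in the chart. -/
theorem exp_neg_two_pi_mul_lt {r M : ℝ} (hr : 0 < r) (hM : 1 < M) (h : Real.log (1 / r) < M) :
    Real.exp (-(2 * Real.pi * M)) < r := by
  rw [← Real.lt_log_iff_exp_lt hr]
  rw [one_div, Real.log_inv] at h
  nlinarith [Real.pi_gt_three]

theorem discProd_mono {r r' : ℝ} (hr : r ≤ r') {K K' : Set ({i : Fin d // i ∉ S} → ℂ)}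
    (hK : K ⊆ K') : discProd S r K ⊆ discProd S r' K' :=
  fun _ hz => ⟨fun i hi => (hz.1 i hi).trans_le hr, hK hz.2⟩

theorem isCompact_closedDisc_prod_point (S : Finset (Fin d)) (ρ : ℝ)
    (y : {i : Fin d // i ∉ S} → ℂ) :
    IsCompact {z : Cd d | (∀ i ∈ S, ‖z i‖ ≤ ρ) ∧ ∀ i : {i : Fin d // i ∉ S}, z i = y i} := by
  convert isCompact_univ_pi (X := fun _ : Fin d => ℂ)
    (s := fun i => if h : i ∈ S then Metric.closedBall (0 : ℂ) ρ else {y ⟨i, h⟩}) fun i => ?_ using 1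
  · ext z
    simp only [mem_univ_pi]
    constructor
    · rintro ⟨h1, h2⟩ i
      by_cases hi : i ∈ S
      · simpa [hi] using h1 i hi
      · simpa [hi] using h2 ⟨i, hi⟩
    · intro h
      exact ⟨fun i hi => by simpa [hi] using h i, fun i => by simpa [i.2] using h i⟩
  · by_cases hi : i ∈ S
    · simpa [hi] using isCompact_closedBall (0 : ℂ) ρ
    · simp [hi]

/-- A neighborhood of a product of closed discs and a point contains a product of discs and a
neighborhood of the point. -/
theorem exists_discProd_subset {ρ : ℝ} {y : {i : Fin d // i ∉ S} → ℂ} {U : Set (Cd d)}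
    (hU : IsOpen U)
    (h : {z : Cd d | (∀ i ∈ S, ‖z i‖ ≤ ρ) ∧ ∀ i : {i : Fin d // i ∉ S}, z i = y i} ⊆ U) :
    ∃ K', IsOpen K' ∧ y ∈ K' ∧ discProd S ρ K' ⊆ U := by
  obtain ⟨δ, hδ, hsub⟩ := (isCompact_closedDisc_prod_point S ρ y).exists_thickening_subset_open hU h
  refine ⟨Metric.ball y δ, Metric.isOpen_ball, Metric.mem_ball_self hδ, fun z hz => hsub ?_⟩
  refine Metric.mem_thickening_iff.2
    ⟨fun i => if hi : i ∈ S then z i else y ⟨i, hi⟩, ⟨fun i hi => ?_, fun i => ?_⟩, ?_⟩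
  · simpa [hi] using (hz.1 i hi).le
  · simp [i.2]
  · refine (dist_pi_lt_iff hδ).2 fun i => ?_
    by_cases hi : i ∈ S
    · simpa [hi] using hδ
    · simpa [hi] using (dist_pi_lt_iff hδ).1 (Metric.mem_ball.1 hz.2) ⟨i, hi⟩

end Products

/-! ### Transfer to adapted charts and the two implications. -/

section Charts

variable {d n : ℕ} {X : Type*} [TopologicalSpace X] [ChartedSpace (Cd d) X]
  {D W : Set X} {φ : OpenPartialHomeomorph X (Cd d)} {S : Finset (Fin d)}

theorem pullback_comp_expMap (hφ : φ ∈ IsManifold.maximalAtlas 𝓘(ℂ, Cd d) ω X) (η : Form d X n)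
    {x : Cd d} (hx : expMap S x ∈ φ.target) :
    pullback (φ.symm ∘ expMap S) η x = (pullback φ.symm η (expMap S x)).compContinuousLinearMap
      ((expDeriv S (expMap S x)).restrictScalars ℝ) := by
  have h1 : MDifferentiableAt 𝓘(ℂ, Cd d) 𝓘(ℂ, Cd d) φ.symm (expMap S x) :=
    ((contMDiffOn_symm_of_mem_maximalAtlas hφ).contMDiffAt
      (φ.open_target.mem_nhds hx)).mdifferentiableAt (by simp)
  have h2 : MDifferentiableAt 𝓘(ℂ, Cd d) 𝓘(ℂ, Cd d) (expMap S) x :=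
    (hasFDerivAt_expMap S x).differentiableAt.mdifferentiableAt
  have h3 : mfderiv 𝓘(ℂ, Cd d) 𝓘(ℂ, Cd d) (expMap S) x = expDeriv S (expMap S x) := by
    rw [mfderiv_eq_fderiv]
    exact (hasFDerivAt_expMap S x).fderiv
  have h4 := mfderiv_comp x h1 h2
  rw [h3] at h4
  unfold pullback
  rw [h4]
  rfl

theorem diff_preimage_eq (hφ : IsCoordinateEquation D φ S) {O : Set (Cd d)} (hO : O ⊆ φ.target) :
    O \ φ.symm ⁻¹' D = O ∩ nonzeroSet S := by
  ext z
  refine and_congr_right fun hz => ?_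
  rw [mem_preimage, hφ.2 _ (φ.map_target (hO hz)), φ.right_inv (hO hz), Finset.prod_eq_zero_iff]
  simp [nonzeroSet]

theorem IsAdapted.norm_le (hφ : IsAdapted D φ S) {z : Cd d} (hz : z ∈ φ.target) (i : Fin d) :
    ‖z i‖ ≤ 1 / Real.exp (Real.exp 1) := by
  have := hφ.2 _ (φ.map_target hz) i
  rwa [φ.right_inv hz] at this

theorem IsAdapted.one_le_logProd (hφ : IsAdapted D φ S) {z : Cd d} (hz : z ∈ φ.target)
    (h0 : z ∈ nonzeroSet S) : 1 ≤ logProd S z :=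
  LogForms.one_le_logProd h0 (hφ.norm_le hz)

theorem IsSmoothFormOn.contDiffOn_pullback {η : Form d X n} (hη : IsSmoothFormOn (W \ D) η)
    (hφ : IsAdapted D φ S) (hW : φ.source ⊆ W) {O : Set (Cd d)} (hO : O ⊆ φ.target) :
    ContDiffOn ℝ ∞ (pullback φ.symm η) (O ∩ nonzeroSet S) := by
  refine (hη φ hφ.1.1).mono fun z hz => ?_
  rw [← diff_preimage_eq hφ.1 hO] at hz
  exact ⟨hO hz.1, hW (φ.map_target (hO hz.1)), hz.2⟩

theorem formHasImPolyGrowth_iff (hφ : IsAdapted D φ S) (hW : φ.source ⊆ W) {η : Form d X n}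
    (hη : IsSmoothFormOn (W \ D) η) {M : ℝ} (hM : 1 < M)
    {K : Set ({i : Fin d // i ∉ S} → ℂ)} (hK : IsOpen K)
    (hsub : discProd S (Real.exp (-(2 * Real.pi * M))) K ⊆ φ.target) :
    FormHasImPolyGrowth S (halfPlaneProd S M K) (pullback (φ.symm ∘ expMap S) η) ↔
      ∀ b, HasLogGrowth S (discProd S (Real.exp (-(2 * Real.pi * M))) K ∩ nonzeroSet S)
        (logComponent S (pullback φ.symm η) b) := by
  have hI := expMap_image_halfPlaneProd S M K
  have hO := isOpen_halfPlaneProd (S := S) M hK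
  have hΛ (x) (hx : x ∈ halfPlaneProd S M K) : 1 ≤ imProd S x := one_le_imProd hM hx
  have hP := isLinearClass_hasImPolyGrowth (n := n) hO hΛ
  rw [FormHasImPolyGrowth, generatedOn_coordForm_iff hP]
  refine forall_congr' fun b => ?_
  rw [← hasImPolyGrowth_comp_expMap_iff hI.symm
    ((isOpen_discProd _ hK).inter (isOpen_nonzeroSet S)) hO
    (fun z hz => hφ.one_le_logProd (hsub hz.1) hz.2) hΛ
    (contDiffOn_logComponent S (hη.contDiffOn_pullback hφ hW hsub) b)]
  have e : EqOn (fun x => pullback (φ.symm ∘ expMap S) η x fun j => frameVec (b j))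
      (logComponent S (pullback φ.symm η) b ∘ expMap S) (halfPlaneProd S M K) := fun x hx => by
    have hx' : expMap S x ∈ φ.target := hsub (hI.subset ⟨x, hx, rfl⟩).1
    simp only [pullback_comp_expMap hφ.1.1 η hx']
    rfl
  exact ⟨fun h => hP.congr _ _ h e.symm, fun h => hP.congr _ _ h e⟩

theorem isLogFormInCoords_inter_nonzeroSet_iff (hφ : IsAdapted D φ S) {O : Set (Cd d)}
    (hO : IsOpen O) (hsub : O ⊆ φ.target) (η : Form d X n) :
    IsLogFormInCoords S (O ∩ nonzeroSet S) (pullback φ.symm η) ↔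
      ∀ b, HasLogGrowth S (O ∩ nonzeroSet S) (logComponent S (pullback φ.symm η) b) :=
  isLogFormInCoords_iff (hO.inter (isOpen_nonzeroSet S))
    (fun _ hz => hφ.one_le_logProd (hsub hz.1) hz.2) (fun _ hz => hz.2) _

/-- The closed polydisc of radius `ρ` over `y` is compact in the chart, so finitely many local
estimates cover it and combine to one on a neighborhood `U`. A tube around it in `U` supplies `K'`.
-/
theorem IsLogForm.hasPolyGrowth {η : Form d X n} (hη : IsSmoothFormOn (W \ D) η)
    (h : IsLogForm D W η) : HasPolyGrowthInLocalUniversalCover D W η := by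
  intro φ S r K hφ hW hr hK ht M hM hrM y hy
  have hρ := exp_neg_two_pi_mul_lt hr hM hrM
  set ρ := Real.exp (-(2 * Real.pi * M))
  have hcov : ∃ U : Set (Cd d), IsOpen U ∧ U ⊆ φ.target ∧
      {z : Cd d | (∀ i ∈ S, ‖z i‖ ≤ ρ) ∧ ∀ i : {i : Fin d // i ∉ S}, z i = y i} ⊆ U ∧
      ∀ b, HasLogGrowth S (U ∩ nonzeroSet S) (logComponent S (pullback φ.symm η) b) := by
    refine (isCompact_closedDisc_prod_point S ρ y).induction_on
      (p := fun s => ∃ U : Set (Cd d), IsOpen U ∧ U ⊆ φ.target ∧ s ⊆ U ∧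
      ∀ b, HasLogGrowth S (U ∩ nonzeroSet S) (logComponent S (pullback φ.symm η) b)) ?_ ?_ ?_ ?_
    · refine ⟨∅, isOpen_empty, empty_subset _, empty_subset _, fun b => ?_⟩
      rw [empty_inter]
      exact fun _ => ⟨fun z hz => absurd hz (notMem_empty z),
        0, fun _ _ _ => ⟨1, one_pos, fun z hz => absurd hz (notMem_empty z)⟩⟩
    · rintro s t hst ⟨U, h1, h2, h3, h4⟩
      exact ⟨U, h1, h2, hst.trans h3, h4⟩
    · rintro s t ⟨U, h1, h2, h3, h4⟩ ⟨V, k1, k2, k3, k4⟩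
      refine ⟨U ∪ V, h1.union k1, union_subset h2 k2, union_subset_union h3 k3, fun b => ?_⟩
      rw [union_inter_distrib_right]
      refine (h4 b).union (h1.inter (isOpen_nonzeroSet S)) (k1.inter (isOpen_nonzeroSet S)) ?_ ?_
        (k4 b)
      · rintro z (hz | hz)
        · exact hφ.one_le_logProd (h2 hz.1) hz.2
        · exact hφ.one_le_logProd (k2 hz.1) hz.2
      · rintro z (hz | hz)
        · exact hz.2
        · exact hz.2
    · rintro z ⟨hz1, hz2⟩
      have hzt : z ∈ φ.target := by
        rw [ht]
        exact ⟨fun i hi => (hz1 i hi).trans_lt hρ, by rwa [show (fun i : {i : Fin d // i ∉ S} =>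
          z i) = y from funext hz2]⟩
      obtain ⟨O, hO, hzO, hOt, hlog⟩ := h φ S hφ hW _ (φ.map_target hzt)
      rw [φ.right_inv hzt] at hzO
      rw [diff_preimage_eq hφ.1 hOt, isLogFormInCoords_inter_nonzeroSet_iff hφ hO hOt] at hlog
      exact ⟨O, mem_nhdsWithin_of_mem_nhds (hO.mem_nhds hzO), O, hO, hOt, Subset.rfl, hlog⟩
  obtain ⟨U, hU, hUt, hQ, hlog⟩ := hcov
  obtain ⟨K', hK', hyK', hsub⟩ := exists_discProd_subset hU hQ
  have hsub' : discProd S ρ (K' ∩ K) ⊆ U := (discProd_mono le_rfl inter_subset_left).trans hsub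
  refine ⟨K' ∩ K, hK'.inter hK, ⟨hyK', hy⟩, inter_subset_right, ?_⟩
  rw [formHasImPolyGrowth_iff hφ hW hη hM (hK'.inter hK) (hsub'.trans hUt)]
  exact fun b => (hlog b).mono (hU.inter (isOpen_nonzeroSet S))
    ((isOpen_discProd _ (hK'.inter hK)).inter (isOpen_nonzeroSet S))
    (fun z hz => hφ.one_le_logProd (hUt hz.1) hz.2) (fun z hz => hz.2)
    (inter_subset_inter_left _ hsub')

/-- Around each of its points, an adapted chart restricts to one whose image is a product. -/
theorem IsAdapted.exists_restr [IsManifold 𝓘(ℂ, Cd d) ω X] (hφ : IsAdapted D φ S) {p : X}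
    (hp : p ∈ φ.source) :
    ∃ (φ' : OpenPartialHomeomorph X (Cd d)) (S' : Finset (Fin d)) (r : ℝ)
      (K : Set ({i : Fin d // i ∉ S'} → ℂ)), IsAdapted D φ' S' ∧ φ'.source ⊆ φ.source ∧ 0 < r ∧
      IsOpen K ∧ φ'.target = discProd S' r K ∧ φ'.target ⊆ φ.target ∧
      (φ'.symm : Cd d → X) = φ.symm ∧ S' ⊆ S ∧ (∀ i ∈ S', φ p i = 0) ∧
      (∀ z ∈ φ'.target, ∀ i ∈ S, i ∉ S' → z i ≠ 0) ∧
      (fun i : {i : Fin d // i ∉ S'} => φ p i) ∈ K := by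
  obtain ⟨r, hr, hball⟩ := Metric.isOpen_iff.1 φ.open_target (φ p) (φ.map_source hp)
  set S' := S.filter fun i => φ p i = 0 with hS'
  have hS'S : S' ⊆ S := Finset.filter_subset _ _
  have hS'0 (i) (hi : i ∈ S') : φ p i = 0 := (Finset.mem_filter.1 hi).2
  -- The coordinates in `S` that do not vanish at `p` are kept away from zero, so that `S'` alone
  -- gives the equation of `D`.
  set K : Set ({i : Fin d // i ∉ S'} → ℂ) :=
    {y | ∀ i ∈ Finset.univ, ‖y i - φ p i‖ < r ∧ (i.1 ∈ S → y i ≠ 0)} with hKdef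
  have hK : IsOpen K := by
    refine isOpen_setOf_forall_mem_finset _ fun i _ => IsOpen.inter
      (isOpen_lt ((continuous_apply i).sub continuous_const).norm continuous_const) ?_
    change IsOpen {y : {i : Fin d // i ∉ S'} → ℂ | i.1 ∈ S → y i ≠ 0}
    by_cases hi : i.1 ∈ S
    · simpa [hi] using isOpen_ne_fun (continuous_apply i) continuous_const
    · simp [hi]
  have hB : discProd S' r K ⊆ φ.target := fun z hz => hball <| by
    rw [Metric.mem_ball, dist_pi_lt_iff hr]
    intro i
    rw [dist_eq_norm]
    by_cases hi : i ∈ S'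
    · rw [hS'0 i hi, sub_zero]
      exact hz.1 i hi
    · exact (hz.2 ⟨i, hi⟩ (Finset.mem_univ _)).1
  set s := φ.source ∩ φ ⁻¹' discProd S' r K with hs
  have hso : IsOpen s := φ.isOpen_inter_preimage (isOpen_discProd r hK)
  have hne (z) (hz : z ∈ discProd S' r K) (i) (hi : i ∈ S) (hi' : i ∉ S') : z i ≠ 0 :=
    (hz.2 ⟨i, hi'⟩ (Finset.mem_univ _)).2 hi
  have hsrc : (φ.restr s).source = s := by
    rw [φ.restr_source' s hso, hs, ← inter_assoc, inter_self]
  have htgt : (φ.restr s).target = discProd S' r K := by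
    rw [OpenPartialHomeomorph.restr_target, hso.interior_eq]
    ext z
    constructor
    · rintro ⟨hz, _, hz'⟩
      rwa [mem_preimage, φ.right_inv hz] at hz'
    · intro hz
      refine ⟨hB hz, φ.map_target (hB hz), ?_⟩
      rwa [mem_preimage, φ.right_inv (hB hz)]
  refine ⟨φ.restr s, S', r, K, ⟨⟨?_, fun q hq => ?_⟩, fun q hq i => ?_⟩, ?_, hr, hK, htgt, ?_, rfl,
    hS'S, hS'0, ?_, fun i _ => ⟨?_, fun hi h0 => ?_⟩⟩
  · exact restr_mem_maximalAtlas _ hφ.1.1 hso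
  · rw [hsrc] at hq
    rw [hφ.1.2 q hq.1, Finset.prod_eq_zero_iff, Finset.prod_eq_zero_iff]
    constructor
    · rintro ⟨i, hi, h0⟩
      refine ⟨i, ?_, h0⟩
      by_contra hi'
      exact hne _ hq.2 i hi hi' h0
    · rintro ⟨i, hi, h0⟩
      exact ⟨i, hS'S hi, h0⟩
  · rw [hsrc] at hq
    exact hφ.2 q hq.1 i
  · rw [hsrc]
    exact inter_subset_left
  · rw [htgt]
    exact hB
  · rw [htgt]
    exact hne
  · simpa using hr
  · exact i.2 (Finset.mem_filter.2 ⟨hi, h0⟩)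

/-- Near `p` the hypothesis is applied to a restricted product chart. The discs of radius `exp
(-2πM)` in the coordinates vanishing at `p` are centered there, so the estimate below holds around
`p`; it concerns `S'` and is then extended to `S`. -/
theorem HasPolyGrowthInLocalUniversalCover.isLogForm [IsManifold 𝓘(ℂ, Cd d) ω X]
    {η : Form d X n} (hη : IsSmoothFormOn (W \ D) η)
    (h : HasPolyGrowthInLocalUniversalCover D W η) : IsLogForm D W η := by
  intro φ S hφ hW p hp
  obtain ⟨φ', S', r, K, hφ', hsrc, hr, hK, htgt, htt, hsymm, hS, hp0, hne, hy⟩ :=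
    hφ.exists_restr hp
  set M := max 1 (Real.log (1 / r)) + 1
  have hM : 1 < M := by linarith [le_max_left 1 (Real.log (1 / r))]
  have hrM : Real.log (1 / r) < M := by linarith [le_max_right 1 (Real.log (1 / r))]
  obtain ⟨K', hK', hyK', hKK', hgrowth⟩ :=
    h φ' S' r K hφ' (hsrc.trans hW) hr hK htgt M hM hrM _ hy
  have hsub : discProd S' (Real.exp (-(2 * Real.pi * M))) K' ⊆ φ'.target := by
    rw [htgt]
    exact discProd_mono (exp_neg_two_pi_mul_lt hr hM hrM).le hKK'
  have hO := isOpen_discProd (S := S') (Real.exp (-(2 * Real.pi * M))) hK'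
  rw [formHasImPolyGrowth_iff hφ' (hsrc.trans hW) hη hM hK' hsub,
    ← isLogFormInCoords_inter_nonzeroSet_iff hφ' hO hsub, hsymm] at hgrowth
  refine ⟨_, hO, ⟨fun i hi => ?_, hyK'⟩, hsub.trans htt, ?_⟩
  · rw [hp0 i hi, norm_zero]
    exact Real.exp_pos _
  -- On the smaller chart the coordinates in `S` outside `S'` never vanish, so both index sets
  -- remove the same divisor.
  · have h0 : discProd S' (Real.exp (-(2 * Real.pi * M))) K' ∩ nonzeroSet S =
        discProd S' (Real.exp (-(2 * Real.pi * M))) K' ∩ nonzeroSet S' := by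
      ext z
      refine and_congr_right fun hz => ⟨fun hzS i hi => hzS i (hS hi), fun hzS i hi => ?_⟩
      by_cases hi' : i ∈ S'
      · exact hzS i hi'
      · exact hne z (hsub hz) i hi hi'
    rw [diff_preimage_eq hφ.1 (hsub.trans htt), h0]
    refine hgrowth.mono_finset hS (hO.inter (isOpen_nonzeroSet S')) (fun z hz => ?_)
      fun z hz => hφ.norm_le (htt (hsub hz.1))
    rw [← h0] at hz
    exact hz.2

end Charts

end LogForms

theorem mainTheorem10 (d n : ℕ) {X : Type*} [TopologicalSpace X]
    [ChartedSpace (LogForms.Cd d) X] [IsManifold 𝓘(ℂ, LogForms.Cd d) ω X]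
    (D : Set X) (hD : LogForms.IsNormalCrossing d D)
    (W : Set X) (hW : IsOpen W)
    (η : LogForms.Form d X n) (hη : LogForms.IsSmoothFormOn (W \ D) η) :
    LogForms.HasPolyGrowthInLocalUniversalCover D W η ↔ LogForms.IsLogForm D W η :=
  ⟨fun h => h.isLogForm hη, fun h => h.hasPolyGrowth hη⟩
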